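/- Let $X$ be a CAT(0) space. A \emph{reflection} of $X$ is an isometry $r$ with $r^2=1$ whose fixed-point set $F_r$ has empty interior and such that $X\setminus F_r$ has exactly two connected components, both convex, which $r$ interchanges. Let $W$ be a group of isometries of $X$ that is generated by reflections and acts properly, i.e. $\{g\in W \mid d(x,gx)<N\}$ is finite for all $x\in X$ and $N>0$. Let $R$ be the set of all reflections in $W$; a \emph{chamber} is a connected component of $X\setminus\bigcup_{r\in R}F_r$. Suppose that $W$ is a cocompact discrete reflection group, i.e. some chamber has compact closure and trivial stabilizer in $W$. Fix a chamber $C$, let $X_r^+$ be the component of $X\setminus F_r$ containing $C$, and let $S\subset R$ be minimal with $C=\bigcap_{s\in S}X_s^+$, i.e. $C\ne\bigcap_{s\in S\setminus\{s_0\}}X_s^+$ for every $s_0\in S$ (then $(W,S)$ is a Coxeter system). Let $\ell$ be the word length on $W$ with respect to $S$, let $o(g)$ be the order of $g$, and for $s\in S$ put $$W^{\{s\}}=\{w\in W \mid \ell(wt)>\ell(w)\text{ for each }t\in S\setminus\{s\}\}\setminus\{1\}.$$ Corollary. If the set $$\bigcup\{W^{\{s\}} \mid s\in S \text{ such that } o(st)=\infty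 \text{ for some } t\in S\}$$ is quasi-dense in $W$ (i.e. there is $N>0$ such that every $w\in W$ satisfies $\ell(w^{-1}a)\le N$ for some $a$ in this set), then $$\{w^\infty \mid w\in W \text{ such that } o(w)=\infty\}$$ is dense in the boundary $\partial X$ (asymptoty classes of geodesic rays, with the cone topology), where $w^\infty\in\partial X$ denotes the limit of the sequence $(w^n x_0)_{n}$ in $X\cup\partial X$, for any $x_0\in X$. -/

import Mathlib

open Filter Topology
open scoped NNReal

namespace ReflCAT

section Geometry

variable {X : Type*} [MetricSpace X]

/-- `γ` restricted to `[0, d(x,y)]` is a geodesic from `x` to `y`. -/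
def IsGeodesic (γ : ℝ → X) (x y : X) : Prop :=
  γ 0 = x ∧ γ (dist x y) = y ∧
    ∀ s ∈ Set.Icc 0 (dist x y), ∀ t ∈ Set.Icc 0 (dist x y), dist (γ s) (γ t) = |s - t|

variable (X) in
/-- Any two points are joined by a geodesic. -/
def IsGeodesicSpace : Prop := ∀ x y : X, ∃ γ : ℝ → X, IsGeodesic γ x y

variable (X) in
/-- CAT(0) space: a geodesic space all of whose geodesic triangles are at least as thin as their
comparison triangles in the Euclidean plane. (Two points on sides of a triangle lie on two sides
issuing from a common vertex `x`, or on one side, where the inequality is trivial.) -/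
def IsCAT0 : Prop :=
  IsGeodesicSpace X ∧
    ∀ (x y z : X) (α β : ℝ → X), IsGeodesic α x y → IsGeodesic β x z →
    ∀ x' y' z' : EuclideanSpace ℝ (Fin 2),
      dist x' y' = dist x y → dist x' z' = dist x z → dist y' z' = dist y z →
    ∀ s ∈ Set.Icc 0 (dist x y), ∀ t ∈ Set.Icc 0 (dist x z),
    ∀ p ∈ segment ℝ x' y', ∀ q ∈ segment ℝ x' z', dist x' p = s → dist x' q = t →
      dist (α s) (β t) ≤ dist p q

/-- A set is convex if it contains every geodesic joining two of its points. -/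
def IsGeodConvex (A : Set X) : Prop :=
  ∀ x ∈ A, ∀ y ∈ A, ∀ γ : ℝ → X, IsGeodesic γ x y → ∀ t ∈ Set.Icc 0 (dist x y), γ t ∈ A

/-! ### Reflections and reflection groups -/

/-- The connected components of a subset `Y`. -/
def componentsOf (Y : Set X) : Set (Set X) :=
  {D | ∃ x ∈ Y, D = connectedComponentIn Y x}

/-- The fixed-point set `F_r` (the wall, if `r` is a reflection). -/
def wall (r : X ≃ᵢ X) : Set X := {x | r x = x}

/-- `r` is a reflection: an involution whose fixed-point set has empty interior and has a
complement with exactly two components, both convex, which `r` exchanges. -/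
def IsReflection (r : X ≃ᵢ X) : Prop :=
  r * r = 1 ∧ interior (wall r) = ∅ ∧
    ∃ A B : Set X, A ≠ B ∧ componentsOf (wall r)ᶜ = {A, B} ∧
      IsGeodConvex A ∧ IsGeodConvex B ∧ r '' A = B ∧ r '' B = A

/-- The set of all reflections in `W`. -/
def reflections (W : Subgroup (X ≃ᵢ X)) : Set (X ≃ᵢ X) := {r | r ∈ W ∧ IsReflection r}

/-- A chamber: a component of the complement of the union of all walls of `W`. -/
def IsChamber (W : Subgroup (X ≃ᵢ X)) (C : Set X) : Prop :=
  C ∈ componentsOf (⋃ r ∈ reflections W, wall r)ᶜ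

/-- `W` is generated by some set of reflections. -/
def IsReflectionGroup (W : Subgroup (X ≃ᵢ X)) : Prop :=
  ∃ R' : Set (X ≃ᵢ X), (∀ r ∈ R', IsReflection r) ∧ Subgroup.closure R' = W

/-- Only finitely many elements of `W` move a point by less than any given bound. -/
def ActsProperly (W : Subgroup (X ≃ᵢ X)) : Prop :=
  ∀ (x : X) (N : ℝ), 0 < N → {g : X ≃ᵢ X | g ∈ W ∧ g x ∈ Metric.ball x N}.Finite

/-- `W` is a cocompact discrete reflection group: a reflection group acting properly, with a
chamber that has compact closure and trivial stabilizer. -/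
def IsCocompactDiscreteReflectionGroup (W : Subgroup (X ≃ᵢ X)) : Prop :=
  IsReflectionGroup W ∧ ActsProperly W ∧
    ∃ C : Set X, IsChamber W C ∧ IsCompact (closure C) ∧ ∀ g ∈ W, g '' C = C → g = 1

/-- `X_r^+`: the component of `X \ F_r` that contains the chamber `C`. -/
def posHalf (C : Set X) (r : X ≃ᵢ X) : Set X := ⋃ c ∈ C, connectedComponentIn (wall r)ᶜ c

/-- `S` is a minimal set of reflections in `W` with `C = ⋂_{s ∈ S} X_s^+`. -/
def IsMinimalCutting (W : Subgroup (X ≃ᵢ X)) (C : Set X) (S : Set (X ≃ᵢ X)) : Prop :=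
  S ⊆ reflections W ∧ C = ⋂ s ∈ S, posHalf C s ∧
    ∀ s₀ ∈ S, C ≠ ⋂ s ∈ S \ {s₀}, posHalf C s

end Geometry

/-! ### Word length -/

section Words

variable {G : Type*} [Group G]

/-- The length of `w` with respect to `S`: the least length of a word in the letters `S` that
represents `w`. It is used where `S` consists of involutions, so that no inverse letters are
needed. -/
noncomputable def wordLength (S : Set G) (w : G) : ℕ :=
  sInf {n : ℕ | ∃ l : List G, (∀ s ∈ l, s ∈ S) ∧ l.prod = w ∧ l.length = n}

/-- The word metric. -/
noncomputable def wordDist (S : Set G) (u v : G) : ℕ := wordLength S (u⁻¹ * v)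

/-- `A` is quasi-dense in `W` for the word metric of `S`. -/
def IsQuasiDense (S : Set G) (W A : Set G) : Prop :=
  A ⊆ W ∧ ∃ N : ℕ, 0 < N ∧ ∀ w ∈ W, ∃ a ∈ A, wordDist S w a ≤ N

/-- `W^{s}`: the nontrivial `w ∈ W` with `ℓ(wt) > ℓ(w)` for every `t ∈ S \ {s}`. -/
def endingOnlyIn (W : Subgroup G) (S : Set G) (s : G) : Set G :=
  {w | w ∈ W ∧ ∀ t ∈ S \ {s}, wordLength S w < wordLength S (w * t)} \ {1}

end Words

/-! ### The boundary at infinity with the cone topology -/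

section Boundary

variable (X : Type*) [MetricSpace X]

/-- Geodesic rays `[0,∞) → X`. -/
def Ray : Type _ := {ξ : ℝ≥0 → X // Isometry ξ}

/-- Two rays are asymptotic if they stay at bounded distance. -/
def raySetoid : Setoid (Ray X) where
  r ξ η := ∃ K : ℝ, ∀ t, dist (ξ.1 t) (η.1 t) ≤ K
  iseqv :=
    { refl := fun ξ => ⟨0, fun t => by simp⟩
      symm := fun ⟨K, h⟩ => ⟨K, fun t => by rw [dist_comm]; exact h t⟩
      trans := fun ⟨K, h⟩ ⟨L, k⟩ =>
        ⟨K + L, fun t => (dist_triangle _ _ _).trans (add_le_add (h t) (k t))⟩ }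

/-- The boundary `∂X`: geodesic rays up to asymptoty. -/
def Boundary : Type _ := Quotient (raySetoid X)

variable {X}

/-- The endpoint `ξ(∞)` of a ray. -/
def Ray.endpoint (ξ : Ray X) : Boundary X := Quotient.mk (raySetoid X) ξ

/-- `y` is the point at distance `r` from `x₀` on a geodesic from `x₀` to `p ∈ X ∪ ∂X`; when `p`
lies in `X` it is required to be at distance more than `r` from `x₀`. -/
def IsPointAt (x₀ : X) (r : ℝ≥0) (y : X) : X ⊕ Boundary X → Prop
  | Sum.inl x => (r : ℝ) < dist x₀ x ∧ ∃ γ : ℝ → X, IsGeodesic γ x₀ x ∧ γ r = y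
  | Sum.inr β => ∃ ξ : Ray X, ξ.1 0 = x₀ ∧ ξ.endpoint = β ∧ ξ.1 r = y

/-- The basic neighbourhood `U(c, r, ε)` in `X ∪ ∂X` of the endpoint of the ray `c`. -/
def coneNhd (c : Ray X) (r : ℝ≥0) (ε : ℝ) : Set (X ⊕ Boundary X) :=
  {p | ∃ y : X, IsPointAt (c.1 0) r y p ∧ dist y (c.1 r) < ε}

/-- The cone topology on `X ∪ ∂X`, described from the base point `x₀`: it is generated by the open
sets of `X` and the sets `U(c, r, ε)` for rays `c` issuing from `x₀`. -/
abbrev coneTopology (x₀ : X) : TopologicalSpace (X ⊕ Boundary X) :=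
  TopologicalSpace.generateFrom
    ({U | ∃ V : Set X, IsOpen V ∧ U = Sum.inl '' V} ∪
      {U | ∃ (c : Ray X) (r : ℝ≥0) (ε : ℝ), c.1 0 = x₀ ∧ 0 < r ∧ 0 < ε ∧ U = coneNhd c r ε})

/-- The cone topology on `∂X`. -/
abbrev boundaryTopology (x₀ : X) : TopologicalSpace (Boundary X) :=
  TopologicalSpace.induced Sum.inr (coneTopology x₀)

/-- `α = w^∞`: the orbit sequence `wⁿ x₀` converges to `α` in `X ∪ ∂X`. -/
def IsLimitOfPowers (x₀ : X) (w : X ≃ᵢ X) (α : Boundary X) : Prop :=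
  Tendsto (fun n : ℕ => (Sum.inl ((w ^ n) x₀) : X ⊕ Boundary X)) atTop
    (@nhds _ (coneTopology x₀) (Sum.inr α))

end Boundary

end ReflCAT

/-! Fix a ray `ξ` from `x₀`. Geodesics issuing from one point diverge at least linearly in a CAT(0)
space, so a ray from `x₀` that passes within a fixed distance `D` of `ξ(T)` is within `r D / T` of
`ξ(r)`. It therefore suffices to find, for every large `T`, an element `w` of infinite order such
that the ray from `x₀` to `w^∞` passes within `D` of `ξ(T)`, with `D` independent of `T`.

Cocompactness and quasi-density supply `a ∈ W^{s}` with `a c` at bounded distance from `ξ(T)`, where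
`c ∈ C` and `st` has infinite order for some `t ∈ S`. Put `w = a (ts) a⁻¹`. The heart of the matter
is that every geodesic from `c` to `wⁿ a c = a (ts)ⁿ c`, `n ≥ 1`, passes through `a C`;
equivalently, geodesics from `a⁻¹ c` to `(ts)ⁿ c` pass through `C` (`exists_mem_of_isGeodesic`).

The walls of `s` and `t` are disjoint, since by properness a common fixed point would make `st` of
finite order. Hence `X_s^+ ∪ X_t^+ = X`. The point `a⁻¹ c` violates only the half-space of `s`,
because no other generator shortens `a` from the right (`inv_apply_mem_posHalf`), and `(ts)ⁿ c`
violates only that of `t` (`pow_apply_mem_posHalf`). By connectedness the geodesic meets `X_s^+ ∩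
X_t^+`, and there convexity of the other half-spaces `X_r^+` puts it in `C`.

That `wⁿ x₀` converges at all follows from an axis: `w` attains a positive least displacement, and
the orbit of a minimizing point lies on a ray (`exists_axis_ray`). -/

namespace ReflCAT

/-! ### Comparison estimates for geodesics in CAT(0) spaces -/

section CAT0

variable {X : Type*} [MetricSpace X]

/-- `γ` is parametrized by arc length and geodesic on `[0, T]`. -/
def UnitSpeedOn (γ : ℝ → X) (T : ℝ) : Prop :=
  ∀ s ∈ Set.Icc 0 T, ∀ t ∈ Set.Icc 0 T, dist (γ s) (γ t) = |s - t|

lemma IsGeodesic.unitSpeedOn {γ : ℝ → X} {x y : X} (h : IsGeodesic γ x y) :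
    UnitSpeedOn γ (dist x y) := h.2.2

lemma UnitSpeedOn.mono {γ : ℝ → X} {T T' : ℝ} (h : UnitSpeedOn γ T) (hT : T' ≤ T) :
    UnitSpeedOn γ T' :=
  fun s hs t ht => h s ⟨hs.1, hs.2.trans hT⟩ t ⟨ht.1, ht.2.trans hT⟩

lemma UnitSpeedOn.dist_zero {γ : ℝ → X} {T : ℝ} (h : UnitSpeedOn γ T) {t : ℝ} (h0 : 0 ≤ t)
    (ht : t ≤ T) : dist (γ 0) (γ t) = t := by
  rw [h 0 ⟨le_rfl, h0.trans ht⟩ t ⟨h0, ht⟩, zero_sub, abs_neg, abs_of_nonneg h0]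

lemma UnitSpeedOn.isGeodesic {γ : ℝ → X} {T : ℝ} (h : UnitSpeedOn γ T) (h0 : 0 ≤ T) :
    IsGeodesic γ (γ 0) (γ T) := by
  have := h.dist_zero h0 le_rfl
  refine ⟨rfl, by rw [this], by rw [this]; exact h⟩

lemma UnitSpeedOn.reverse {γ : ℝ → X} {T : ℝ} (h : UnitSpeedOn γ T) :
    UnitSpeedOn (fun t => γ (T - t)) T := by
  intro s hs t ht
  rw [h _ ⟨by linarith [hs.2], by linarith [hs.1]⟩ _ ⟨by linarith [ht.2], by linarith [ht.1]⟩,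
    show T - s - (T - t) = -(s - t) by ring, abs_neg]

lemma UnitSpeedOn.continuousOn {γ : ℝ → X} {T : ℝ} (h : UnitSpeedOn γ T) :
    ContinuousOn γ (Set.Icc 0 T) := by
  have : LipschitzOnWith 1 γ (Set.Icc 0 T) :=
    LipschitzOnWith.of_dist_le_mul fun s hs t ht => by
      rw [h s hs t ht, Real.dist_eq]; simp
  exact this.continuousOn

lemma UnitSpeedOn.comp_isometry {γ : ℝ → X} {T : ℝ} (h : UnitSpeedOn γ T) (g : X ≃ᵢ X) :
    UnitSpeedOn (fun t => g (γ t)) T := by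
  intro s hs t ht
  rw [g.dist_eq, h s hs t ht]

lemma IsGeodesic.comp_isometry {γ : ℝ → X} {x y : X} (h : IsGeodesic γ x y) (g : X ≃ᵢ X) :
    IsGeodesic (fun t => g (γ t)) (g x) (g y) := by
  refine ⟨by simp [h.1], by simp [g.dist_eq, h.2.1], ?_⟩
  rw [g.dist_eq]
  exact h.unitSpeedOn.comp_isometry g

lemma Ray.unitSpeedOn (ξ : Ray X) (T : ℝ) : UnitSpeedOn (fun t => ξ.1 t.toNNReal) T := by
  intro s hs t ht
  rw [ξ.2.dist_eq, NNReal.dist_eq, Real.coe_toNNReal _ hs.1, Real.coe_toNNReal _ ht.1]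

/-- An isosceles comparison triangle. -/
lemma exists_isosceles {T e : ℝ} (h0 : 0 ≤ e) (h : e ≤ 2 * T) :
    ∃ x y z : EuclideanSpace ℝ (Fin 2), dist x y = T ∧ dist x z = T ∧ dist y z = e := by
  have hn : 0 ≤ T ^ 2 - (e / 2) ^ 2 := by nlinarith
  refine ⟨!₂[0, √(T ^ 2 - (e / 2) ^ 2)], !₂[-(e / 2), 0], !₂[e / 2, 0], ?_, ?_, ?_⟩
  · rw [EuclideanSpace.dist_eq, Real.sqrt_eq_iff_mul_self_eq (by positivity) (by linarith)]
    simp [Real.dist_eq, sq_abs, Real.sq_sqrt hn]; ring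
  · rw [EuclideanSpace.dist_eq, Real.sqrt_eq_iff_mul_self_eq (by positivity) (by linarith)]
    simp [Real.dist_eq, sq_abs, Real.sq_sqrt hn]; ring
  · rw [EuclideanSpace.dist_eq, Real.sqrt_eq_iff_mul_self_eq (by positivity) (by linarith)]
    simp [Real.dist_eq, sq_abs]; ring

/-- Two geodesics issuing from one point diverge at least linearly. -/
lemma IsCAT0.dist_le (hX : IsCAT0 X) {α β : ℝ → X} {T r : ℝ} (hα : UnitSpeedOn α T)
    (hβ : UnitSpeedOn β T) (h0 : α 0 = β 0) (hT : 0 < T) (hr0 : 0 ≤ r) (hr : r ≤ T) :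
    dist (α r) (β r) ≤ r / T * dist (α T) (β T) := by
  have hα0 := hα.dist_zero hT.le le_rfl
  have hβ0 := hβ.dist_zero hT.le le_rfl
  obtain ⟨x, y, z, hxy, hxz, hyz⟩ := exists_isosceles (T := T) (e := dist (α T) (β T))
    dist_nonneg (by linarith [dist_triangle_left (α T) (β T) (α 0), h0 ▸ hβ0])
  have hrT : 0 ≤ r / T := by positivity
  have hrT1 : r / T ≤ 1 := (div_le_one hT).2 hr
  have key := hX.2 (α 0) (α T) (β T) α β (hα.isGeodesic hT.le) (h0 ▸ hβ.isGeodesic hT.le) x y z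
    (by rw [hxy, hα0]) (by rw [hxz, h0, hβ0]) hyz r (by rw [hα0]; exact ⟨hr0, hr⟩) r
    (by rw [h0, hβ0]; exact ⟨hr0, hr⟩)
    (AffineMap.lineMap x y (r / T)) ?_ (AffineMap.lineMap x z (r / T)) ?_ ?_ ?_
  · refine key.trans_eq ?_
    rw [AffineMap.lineMap_apply, AffineMap.lineMap_apply, dist_vadd_cancel_right, dist_smul₀,
      dist_vsub_cancel_right, hyz, Real.norm_of_nonneg hrT]
  · rw [segment_eq_image_lineMap]; exact ⟨_, ⟨hrT, hrT1⟩, rfl⟩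
  · rw [segment_eq_image_lineMap]; exact ⟨_, ⟨hrT, hrT1⟩, rfl⟩
  · rw [dist_left_lineMap, hxy, Real.norm_of_nonneg hrT]; field_simp
  · rw [dist_left_lineMap, hxz, Real.norm_of_nonneg hrT]; field_simp

lemma IsCAT0.dist_le_of_le (hX : IsCAT0 X) {α β : ℝ → X} {T r : ℝ} (hα : UnitSpeedOn α T)
    (hβ : UnitSpeedOn β T) (h0 : α 0 = β 0) (hr0 : 0 ≤ r) (hr : r ≤ T) :
    dist (α r) (β r) ≤ dist (α T) (β T) := by
  rcases (hr0.trans hr).eq_or_lt with hT | hT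
  · have : r = T := by linarith
    rw [this]
  · refine (hX.dist_le hα hβ h0 hT hr0 hr).trans ?_
    exact mul_le_of_le_one_left dist_nonneg ((div_le_one hT).2 hr)

lemma IsCAT0.eq_of_unitSpeedOn (hX : IsCAT0 X) {α β : ℝ → X} {T r : ℝ} (hα : UnitSpeedOn α T)
    (hβ : UnitSpeedOn β T) (h0 : α 0 = β 0) (hT : α T = β T) (hr0 : 0 ≤ r) (hr : r ≤ T) :
    α r = β r := by
  have := hX.dist_le_of_le hα hβ h0 hr0 hr
  rw [hT, dist_self] at this
  exact dist_le_zero.1 this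

/-- Geodesics with a common endpoint and nearby origins stay close. -/
lemma IsCAT0.dist_le_of_common_end (hX : IsCAT0 X) {α β : ℝ → X} {x y z : X}
    (hα : IsGeodesic α x z) (hβ : IsGeodesic β y z) {t : ℝ} (h0 : 0 ≤ t) (hx : t ≤ dist x z)
    (hy : t ≤ dist y z) : dist (α t) (β t) ≤ 3 * dist x y := by
  wlog hle : dist x z ≤ dist y z generalizing x y α β
  · rw [dist_comm, dist_comm x y]
    exact this hβ hα hy hx (le_of_not_ge hle)
  set a := dist x z
  set b := dist y z
  have hb : b ≤ dist x y + a := by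
    simpa [a, b, dist_comm] using dist_triangle y x z
  have hα' := hα.unitSpeedOn.reverse
  have hβ' := hβ.unitSpeedOn.reverse.mono hle
  -- Seen from `z`, both geodesics are compared up to length `a`. Their ends `x` and `β (b - a)` are
  -- at most `2 d(x,y)` apart, and matching the parameters of `β` costs another `d(x,y)`; hence the
  -- factor 3.
  have h1 := hX.dist_le_of_le hα' hβ' (by simp [hα.2.1, hβ.2.1]) (r := a - t) (by linarith)
    (by linarith)
  have e1 : dist (β (b - (a - t))) (β t) ≤ dist x y := by
    rw [hβ.2.2 _ ⟨by linarith, by linarith⟩ _ ⟨h0, hy⟩, abs_le]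
    constructor <;> linarith [dist_nonneg (x := x) (y := y)]
  have e2 : dist (β (b - a)) y ≤ dist x y := by
    have := hβ.2.2 (b - a) ⟨by linarith, by linarith [dist_nonneg (x := x) (y := z)]⟩ 0
      ⟨le_rfl, dist_nonneg⟩
    rw [hβ.1] at this
    rw [this, abs_le]
    constructor <;> linarith [dist_nonneg (x := x) (y := y)]
  simp only [sub_self, hα.1] at h1
  rw [show dist x z - (a - t) = t from sub_sub_cancel a t] at h1
  have e3 := dist_triangle x y (β (b - a))
  rw [dist_comm y] at e3
  linarith [dist_triangle (α t) (β (b - (a - t))) (β t)]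

lemma IsGeodConvex.isPreconnected (hX : IsGeodesicSpace X) {A : Set X} (hA : IsGeodConvex A) :
    IsPreconnected A := by
  refine isPreconnected_of_forall_pair fun x hx y hy => ?_
  obtain ⟨γ, hγ⟩ := hX x y
  refine ⟨γ '' Set.Icc 0 (dist x y), ?_, ⟨0, ⟨le_rfl, dist_nonneg⟩, hγ.1⟩,
    ⟨_, ⟨dist_nonneg, le_rfl⟩, hγ.2.1⟩, isPreconnected_Icc.image _ hγ.unitSpeedOn.continuousOn⟩
  rintro _ ⟨t, ht, rfl⟩
  exact hA x hx y hy γ hγ t ht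

lemma isPreconnected_ball (hX : IsGeodesicSpace X) (p : X) (ε : ℝ) :
    IsPreconnected (Metric.ball p ε) := by
  refine isPreconnected_of_forall p fun y hy => ?_
  obtain ⟨γ, hγ⟩ := hX p y
  refine ⟨γ '' Set.Icc 0 (dist p y), ?_, ⟨0, ⟨le_rfl, dist_nonneg⟩, hγ.1⟩,
    ⟨_, ⟨dist_nonneg, le_rfl⟩, hγ.2.1⟩, isPreconnected_Icc.image _ hγ.unitSpeedOn.continuousOn⟩
  rintro _ ⟨t, ht, rfl⟩
  have := hγ.unitSpeedOn.dist_zero ht.1 ht.2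
  rw [hγ.1] at this
  rw [Metric.mem_ball, dist_comm, this]
  exact ht.2.trans_lt (by rwa [Metric.mem_ball, dist_comm] at hy)

/-- An isometry carries a geodesic between two fixed points to one with the same endpoints, and
geodesics are unique. Convexity makes walls connected, so a wall disjoint from another lies on one
side of it. -/
lemma IsCAT0.isGeodConvex_wall (hX : IsCAT0 X) (g : X ≃ᵢ X) : IsGeodConvex (wall g) := by
  intro x hx y hy γ hγ t ht
  have h := hγ.comp_isometry g
  rw [show g x = x from hx, show g y = y from hy] at h
  exact hX.eq_of_unitSpeedOn h.unitSpeedOn hγ.unitSpeedOn (h.1.trans hγ.1.symm)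
    (h.2.1.trans hγ.2.1.symm) ht.1 ht.2

/-- Asymptotic rays issuing from one point coincide. -/
lemma IsCAT0.ray_eq (hX : IsCAT0 X) {ξ η : Ray X} (h0 : ξ.1 0 = η.1 0)
    (h : ξ.endpoint = η.endpoint) (r : ℝ≥0) : ξ.1 r = η.1 r := by
  obtain ⟨K, hK⟩ : ∃ K : ℝ, ∀ t, dist (ξ.1 t) (η.1 t) ≤ K := Quotient.exact h
  have hK0 : 0 ≤ K := dist_nonneg.trans (hK 0)
  by_contra hne
  have hd : 0 < dist (ξ.1 r) (η.1 r) := dist_pos.2 hne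
  set d := dist (ξ.1 r) (η.1 r)
  -- Large enough that linear divergence, `d ≤ (r / T) K`, fails.
  set T : ℝ := r + 1 + r * K / d
  have hT : (r : ℝ) + 1 ≤ T := by
    have : 0 ≤ r * K / d := by positivity
    simp only [T]; linarith
  have hT0 : 0 < T := by linarith [r.2]
  have key := hX.dist_le (ξ.unitSpeedOn T) (η.unitSpeedOn T) (by simpa using h0) hT0
    r.coe_nonneg (by linarith)
  simp only [Real.toNNReal_coe] at key
  have h2 : d ≤ r / T * K := key.trans (mul_le_mul_of_nonneg_left (hK _) (by positivity))
  rw [div_mul_eq_mul_div, le_div_iff₀ hT0] at h2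
  have : d * T = d * (r + 1) + r * K := by simp only [T]; field_simp
  nlinarith [r.2]

end CAT0

/-! ### Rays, convergence to rays, and axes -/

section Rays

variable {X : Type*} [MetricSpace X]

/-- Every boundary point of a proper CAT(0) space is represented by a ray issuing from any given
point. -/
lemma IsCAT0.exists_ray [ProperSpace X] (hX : IsCAT0 X) (ρ : Ray X) (x₀ : X) :
    ∃ η : Ray X, η.1 0 = x₀ ∧ η.endpoint = ρ.endpoint := by
  choose γ hγ using fun n : ℕ => hX.1 x₀ (ρ.1 n)
  set δ := dist x₀ (ρ.1 0)
  have hlen : ∀ n : ℕ, (n : ℝ) - δ ≤ dist x₀ (ρ.1 n) := fun n => by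
    have h1 : dist (ρ.1 0) (ρ.1 n) = n := by rw [ρ.2.dist_eq, NNReal.dist_eq]; simp
    linarith [dist_triangle_left (ρ.1 0) (ρ.1 n) x₀]
  have hev : ∀ t : ℝ≥0, ∀ᶠ n : ℕ in atTop, (t : ℝ) ≤ dist x₀ (ρ.1 n) ∧ t ≤ n := fun t => by
    filter_upwards [eventually_ge_atTop ⌈(t : ℝ) + δ⌉₊] with n hn
    have : (t : ℝ) + δ ≤ n := (Nat.le_ceil _).trans (by exact_mod_cast hn)
    refine ⟨by linarith [hlen n], ?_⟩
    have h0 : 0 ≤ δ := dist_nonneg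
    exact_mod_cast (by linarith : (t : ℝ) ≤ n)
  -- Limits along one fixed ultrafilter exist for all `t` at once, as closed balls are compact; no
  -- diagonal subsequence is needed.
  have hU : (hyperfilter ℕ : Filter ℕ) ≤ atTop := Nat.hyperfilter_le_atTop
  have hlim : ∀ t : ℝ≥0, ∃ y, Tendsto (fun n => γ n t) (hyperfilter ℕ : Filter ℕ) (𝓝 y) := by
    intro t
    have hmem : ∀ᶠ n in (hyperfilter ℕ : Filter ℕ), γ n t ∈ Metric.closedBall x₀ t := by
      filter_upwards [hU (hev t)] with n hn
      have := (hγ n).unitSpeedOn.dist_zero t.coe_nonneg hn.1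
      rw [(hγ n).1] at this
      rw [Metric.mem_closedBall, dist_comm, this]
    obtain ⟨y, -, hy⟩ := (isCompact_closedBall x₀ (t : ℝ)).ultrafilter_le_nhds'
      ((hyperfilter ℕ).map fun n => γ n t) hmem
    exact ⟨y, hy⟩
  choose η hη using hlim
  have hiso : Isometry η := Isometry.of_dist_eq fun s t => by
    refine tendsto_nhds_unique ((hη s).dist (hη t)) (tendsto_const_nhds.congr' ?_)
    filter_upwards [hU (hev s), hU (hev t)] with n hs ht
    rw [(hγ n).2.2 s ⟨s.2, hs.1⟩ t ⟨t.2, ht.1⟩, NNReal.dist_eq]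
  refine ⟨⟨η, hiso⟩, ?_, Quotient.sound ⟨3 * δ, fun t => ?_⟩⟩
  · refine tendsto_nhds_unique (hη 0) (tendsto_const_nhds.congr fun n => ?_)
    simp [(hγ n).1]
  · refine le_of_tendsto ((hη t).dist tendsto_const_nhds) ?_
    filter_upwards [hU (hev t)] with n hn
    have hg := (ρ.unitSpeedOn n).isGeodesic n.cast_nonneg
    simp only [Real.toNNReal_zero, Real.toNNReal_natCast] at hg
    have := hX.dist_le_of_common_end (hγ n) hg t.coe_nonneg hn.1 (by
      rw [ρ.2.dist_eq, NNReal.dist_eq]; simpa using by exact_mod_cast hn.2)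
    simpa using this

/-- Geodesics to points that go to infinity near a ray converge to the ray. -/
lemma IsCAT0.eventually_close (hX : IsCAT0 X) (η : Ray X) {z : ℕ → X} {τ : ℕ → ℝ≥0} {K : ℝ}
    (hτ : Tendsto τ atTop atTop) (hz : ∀ n, dist (z n) (η.1 (τ n)) ≤ K) (r : ℝ≥0) {ε : ℝ}
    (hε : 0 < ε) : ∀ᶠ n in atTop, (r : ℝ) < dist (η.1 0) (z n) ∧
      ∀ γ, IsGeodesic γ (η.1 0) (z n) → dist (γ r) (η.1 r) < ε := by
  have hK : 0 ≤ K := dist_nonneg.trans (hz 0)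
  -- At parameter `T` the two geodesics will be at most `4K` apart; `T ≥ B` makes `(r / T) 4K < ε`.
  set B : ℝ := r * (4 * K) / ε + r + 1
  have hq : 0 ≤ r * (4 * K) / ε := by positivity
  have hr := r.coe_nonneg
  filter_upwards [hτ.eventually_ge_atTop (Real.toNNReal (B + K))] with n hn
  have hn' : B + K ≤ τ n := Real.toNNReal_le_iff_le_coe.1 hn
  have hητ : dist (η.1 0) (η.1 (τ n)) = τ n := by rw [η.2.dist_eq, NNReal.dist_eq]; simp
  have h1 : (τ n : ℝ) - K ≤ dist (η.1 0) (z n) := by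
    linarith [dist_triangle (η.1 0) (z n) (η.1 (τ n)), hz n]
  have h2 : dist (η.1 0) (z n) ≤ τ n + K := by
    linarith [dist_triangle_right (η.1 0) (z n) (η.1 (τ n)), hz n]
  refine ⟨by simp only [B] at *; linarith, fun γ hγ => ?_⟩
  set T : ℝ := τ n - K
  have hBT : B ≤ T := by simp only [T]; linarith
  have hrT : r + 1 ≤ T := by simp only [B] at *; linarith
  have hT0 : 0 < T := by linarith
  have hη := η.unitSpeedOn (τ n)
  have key := hX.dist_le (hγ.unitSpeedOn.mono h1) (hη.mono (by simp only [T]; linarith))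
    (by simp [hγ.1]) hT0 hr (by linarith)
  have e1 : dist (γ T) (z n) ≤ 2 * K := by
    have := hγ.2.2 T ⟨hT0.le, h1⟩ _ ⟨dist_nonneg, le_rfl⟩
    rw [hγ.2.1] at this
    rw [this, abs_le]; constructor <;> simp only [T] <;> linarith
  have e2 : dist (η.1 T.toNNReal) (η.1 (τ n)) ≤ K := by
    have := hη T ⟨hT0.le, by simp only [T]; linarith⟩ (τ n) ⟨(τ n).2, le_rfl⟩
    simp only [Real.toNNReal_coe] at this
    rw [this, abs_le]; constructor <;> simp only [T] <;> linarith
  have e3 : dist (γ T) (η.1 T.toNNReal) ≤ 4 * K := by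
    have := dist_triangle4 (γ T) (z n) (η.1 (τ n)) (η.1 T.toNNReal)
    rw [dist_comm (η.1 (τ n))] at this
    linarith [hz n]
  simp only [Real.toNNReal_coe] at key
  refine (key.trans (mul_le_mul_of_nonneg_left e3 (by positivity))).trans_lt ?_
  rw [div_mul_eq_mul_div, div_lt_iff₀ hT0, ← div_lt_iff₀' hε]
  simp only [B] at hBT; linarith

/-- Since the total length is the distance of the endpoints, the triangle inequality is an equality
for every pair of points on different pieces. -/
lemma UnitSpeedOn.concat {α β : ℝ → X} {a b : ℝ} (hα : UnitSpeedOn α a) (hβ : UnitSpeedOn β b)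
    (ha : 0 ≤ a) (hb : 0 ≤ b) (h : α a = β 0) (hd : dist (α 0) (β b) = a + b) :
    UnitSpeedOn (fun t => if t ≤ a then α t else β (t - a)) (a + b) := by
  have mixed : ∀ s t, 0 ≤ s → s ≤ a → a ≤ t → t ≤ a + b → dist (α s) (β (t - a)) = t - s := by
    intro s t h0 hs ht htb
    have e1 : dist (α s) (α a) = a - s := by
      rw [hα s ⟨h0, hs⟩ a ⟨ha, le_rfl⟩, abs_sub_comm, abs_of_nonneg (by linarith)]
    have e2 : dist (β 0) (β (t - a)) = t - a := hβ.dist_zero (by linarith) (by linarith)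
    have e3 : dist (α 0) (α s) = s := hα.dist_zero h0 hs
    have e4 : dist (β (t - a)) (β b) = a + b - t := by
      rw [hβ _ ⟨by linarith, by linarith⟩ b ⟨hb, le_rfl⟩, abs_sub_comm,
        abs_of_nonneg (by linarith)]
      ring
    apply le_antisymm
    · have := dist_triangle (α s) (α a) (β (t - a))
      rw [h] at this e1
      linarith
    · have := dist_triangle4 (α 0) (α s) (β (t - a)) (β b)
      linarith
  intro s hs t ht
  rcases le_or_gt s a with h1 | h1 <;> rcases le_or_gt t a with h2 | h2
  · simp only [h1, h2, if_true]
    exact hα s ⟨hs.1, h1⟩ t ⟨ht.1, h2⟩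
  · simp only [h1, h2.not_ge, if_true, if_false]
    rw [mixed s t hs.1 h1 h2.le ht.2, abs_sub_comm, abs_of_nonneg (by linarith)]
  · simp only [h2, h1.not_ge, if_true, if_false]
    rw [dist_comm, mixed t s ht.1 h2 h1.le hs.2, abs_of_nonneg (by linarith)]
  · simp only [h2.not_ge, h1.not_ge, if_false]
    rw [hβ _ ⟨by linarith, by linarith [hs.2]⟩ _ ⟨by linarith, by linarith [ht.2]⟩]
    congr 1; ring

/-- A sequence of equally spaced points whose distances add up lies on a ray. -/
lemma IsCAT0.exists_ray_through (hX : IsCAT0 X) {p : ℕ → X} {L : ℝ} (hL : 0 < L)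
    (hp : ∀ m n : ℕ, m ≤ n → dist (p m) (p n) = (n - m) * L) :
    ∃ ρ : Ray X, ∀ n : ℕ, ρ.1 (n * L.toNNReal) = p n := by
  choose γ hγ using fun n : ℕ => hX.1 (p 0) (p n)
  have hd : ∀ n, dist (p 0) (p n) = n * L := fun n => by simpa using hp 0 n n.zero_le
  have hu : ∀ n, UnitSpeedOn (γ n) (n * L) := fun n => hd n ▸ (hγ n).unitSpeedOn
  have hend : ∀ n : ℕ, γ n (n * L) = p n := fun n => by rw [← hd n]; exact (hγ n).2.1
  -- Continuing `γ m` by a geodesic from `p m` to `p n` gives a geodesic, because the distances add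
  -- up; uniqueness identifies it with `γ n`.
  have hcoh : ∀ m n : ℕ, m ≤ n → ∀ t : ℝ, 0 ≤ t → t ≤ m * L → γ n t = γ m t := by
    intro m n hmn t h0 ht
    obtain ⟨β, hβ⟩ := hX.1 (p m) (p n)
    have hm : (m : ℝ) ≤ n := by exact_mod_cast hmn
    have hβu := hβ.unitSpeedOn
    have hβe := hβ.2.1
    rw [hp m n hmn] at hβu hβe
    have hc := (hu m).concat hβu (by positivity) (mul_nonneg (by linarith) hL.le)
      (by rw [hend, hβ.1]) (by rw [hβe, (hγ m).1, hd]; ring)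
    have hsum : (m : ℝ) * L + (n - m) * L = n * L := by ring
    rw [hsum] at hc
    have hmL : (m : ℝ) * L ≤ n * L := mul_le_mul_of_nonneg_right hm hL.le
    have := hX.eq_of_unitSpeedOn (hu n) hc
      (by rw [if_pos (by positivity), (hγ n).1, (hγ m).1]) ?_ h0 (ht.trans hmL)
    · simpa [ht] using this
    · rw [hend]
      rcases hmn.eq_or_lt with rfl | hlt
      · simp [hend]
      · have : ¬ (n : ℝ) * L ≤ m * L := by
          rw [not_le]; exact mul_lt_mul_of_pos_right (by exact_mod_cast hlt) hL
        rw [if_neg this, ← sub_mul, hβe]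
  set N : ℝ≥0 → ℕ := fun t => ⌈(t : ℝ) / L⌉₊
  have hN : ∀ t : ℝ≥0, (t : ℝ) ≤ N t * L := fun t => (div_le_iff₀ hL).1 (Nat.le_ceil _)
  refine ⟨⟨fun t => γ (N t) t, Isometry.of_dist_eq fun s t => ?_⟩, fun n => ?_⟩
  · rw [← hcoh _ _ (le_max_left (N s) (N t)) s s.2 (hN s),
      ← hcoh _ _ (le_max_right (N s) (N t)) t t.2 (hN t), NNReal.dist_eq]
    refine hu _ _ ⟨s.2, (hN s).trans ?_⟩ _ ⟨t.2, (hN t).trans ?_⟩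
    · exact mul_le_mul_of_nonneg_right (by exact_mod_cast le_max_left _ _) hL.le
    · exact mul_le_mul_of_nonneg_right (by exact_mod_cast le_max_right _ _) hL.le
  · have e : ((n * L.toNNReal : ℝ≥0) : ℝ) = n * L := by
      simp [hL.le]
    have hNn : N (n * L.toNNReal) = n := by
      simp only [N, e, mul_div_cancel_right₀ _ hL.ne', Nat.ceil_natCast]
    change γ (N (n * L.toNNReal)) ((n * L.toNNReal : ℝ≥0) : ℝ) = p n
    rw [hNn, e, hend]

/-- If `m` is the midpoint of `[x, g x]`, then `g m` is the midpoint of `[g x, g² x]`. Comparison at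
the vertex `g x` gives `L ≤ d(m, g m) ≤ d(x, g² x) / 2`. -/
lemma IsCAT0.two_mul_le_displacement (hX : IsCAT0 X) {g : X ≃ᵢ X} {L : ℝ}
    (hL : ∀ x, L ≤ dist x (g x)) (x : X) : 2 * L ≤ dist x ((g * g) x) := by
  rcases (dist_nonneg (x := x) (y := g x)).eq_or_lt with h | h
  · linarith [hL x, dist_nonneg (x := x) (y := (g * g) x)]
  obtain ⟨γ, hγ⟩ := hX.1 x (g x)
  have key := hX.dist_le hγ.unitSpeedOn.reverse (hγ.unitSpeedOn.comp_isometry g)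
    (by simp [hγ.1, hγ.2.1]) h (r := dist x (g x) / 2) (by linarith) (by linarith)
  rw [div_right_comm, div_self h.ne'] at key
  simp only [sub_self, hγ.1, hγ.2.1, sub_half] at key
  have := hL (γ (dist x (g x) / 2))
  have e : (g * g) x = g (g x) := rfl
  rw [e]
  linarith

/-- A point of least displacement is moved along an axis. -/
lemma IsCAT0.dist_pow_eq (hX : IsCAT0 X) {g : X ≃ᵢ X} {y : X}
    (hy : ∀ x, dist y (g y) ≤ dist x (g x)) (n : ℕ) :
    dist y ((g ^ n) y) = n * dist y (g y) := by
  set L := dist y (g y)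
  have hup : ∀ n : ℕ, ∀ x, x = y → dist x ((g ^ n) x) ≤ n * L := by
    rintro n x rfl
    induction n with
    | zero => simp
    | succ k ih =>
      have e : dist ((g ^ k) x) ((g ^ (k + 1)) x) = L := by
        rw [pow_succ]; exact (g ^ k).dist_eq x (g x)
      push_cast
      linarith [dist_triangle x ((g ^ k) x) ((g ^ (k + 1)) x)]
  -- Doubling gives the lower bound for powers of two. A general `n` follows by subtracting the
  -- upper bound for the remaining `2 ^ n - n` steps.
  have hlow : ∀ k : ℕ, ∀ x, 2 ^ k * L ≤ dist x ((g ^ 2 ^ k) x) := by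
    intro k
    induction k with
    | zero => simpa using hy
    | succ k ih =>
      intro x
      have := hX.two_mul_le_displacement ih x
      rw [← pow_add, ← two_mul, ← pow_succ'] at this
      rw [pow_succ]; linarith
  refine le_antisymm (hup n y rfl) ?_
  have hn : n ≤ 2 ^ n := Nat.lt_two_pow_self.le
  have e : dist ((g ^ n) y) ((g ^ 2 ^ n) y) ≤ (2 ^ n - n : ℝ) * L := by
    have h := hup (2 ^ n - n) y rfl
    rw [Nat.cast_sub hn] at h
    rw [← Nat.add_sub_cancel' hn, pow_add]
    refine ((g ^ n).dist_eq y ((g ^ (2 ^ n - n)) y)).trans_le ?_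
    simpa using h
  linarith [hlow n y, dist_triangle y ((g ^ n) y) ((g ^ 2 ^ n) y)]

end Rays

/-! ### Reflections and their half-spaces -/

section HalfSpaces

variable {X : Type*} [MetricSpace X]

lemma isClosed_wall (r : X ≃ᵢ X) : IsClosed (wall r) :=
  isClosed_eq r.continuous continuous_id

lemma IsReflection.apply_apply {r : X ≃ᵢ X} (hr : IsReflection r) (x : X) : r (r x) = x := by
  have := congrArg (fun g : X ≃ᵢ X => g x) hr.1
  simpa using this

lemma IsReflection.inv_eq {r : X ≃ᵢ X} (hr : IsReflection r) : r⁻¹ = r :=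
  inv_eq_of_mul_eq_one_left hr.1

lemma wall_conj (g r : X ≃ᵢ X) : wall (g * r * g⁻¹) = g '' wall r := by
  ext x
  simp only [wall, Set.mem_ofPred_eq, Set.mem_image, IsometryEquiv.mul_apply]
  constructor
  · intro h
    refine ⟨g⁻¹ x, ?_, g.apply_symm_apply x⟩
    apply g.injective
    rw [h]; exact (g.apply_symm_apply x).symm
  · rintro ⟨y, hy, rfl⟩
    rw [IsometryEquiv.inv_apply_self, hy]

lemma IsGeodConvex.image {A : Set X} (hA : IsGeodConvex A) (g : X ≃ᵢ X) :
    IsGeodConvex (g '' A) := by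
  rintro _ ⟨x, hx, rfl⟩ _ ⟨y, hy, rfl⟩ γ hγ t ht
  have h := hγ.comp_isometry g⁻¹
  simp only [IsometryEquiv.inv_apply_self] at h
  exact ⟨_, hA x hx y hy _ h t (by rwa [g.dist_eq] at ht), g.apply_symm_apply _⟩

lemma componentsOf_image (Y : Set X) (g : X ≃ᵢ X) :
    componentsOf (g '' Y) = (g '' ·) '' componentsOf Y := by
  ext D
  constructor
  · rintro ⟨_, ⟨x, hx, rfl⟩, rfl⟩
    exact ⟨_, ⟨x, hx, rfl⟩, g.toHomeomorph.image_connectedComponentIn hx⟩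
  · rintro ⟨_, ⟨x, hx, rfl⟩, rfl⟩
    exact ⟨g x, ⟨x, hx, rfl⟩, g.toHomeomorph.image_connectedComponentIn hx⟩

lemma IsReflection.conj {r : X ≃ᵢ X} (hr : IsReflection r) (g : X ≃ᵢ X) :
    IsReflection (g * r * g⁻¹) := by
  obtain ⟨h1, h2, A, B, hAB, hcomp, hA, hB, hrA, hrB⟩ := hr
  have himg : ∀ A B : Set X, r '' A = B → (g * r * g⁻¹) '' (g '' A) = g '' B := by
    rintro A _ rfl
    simp only [Set.image_image, IsometryEquiv.mul_apply, IsometryEquiv.inv_apply_self]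
  refine ⟨?_, ?_, g '' A, g '' B, ?_, ?_, hA.image g, hB.image g, himg _ _ hrA, himg _ _ hrB⟩
  · rw [conj_mul, h1]; simp
  · rw [wall_conj]
    have := g.toHomeomorph.image_interior (wall r)
    rw [h2, Set.image_empty] at this
    exact this.symm
  · exact fun h => hAB (g.injective.image_injective h)
  · rw [wall_conj, ← Set.image_compl_eq g.bijective, componentsOf_image, hcomp, Set.image_pair]

/-- `P` is one of the two open sides of the wall of the reflection `r`. -/
structure IsHalfSpace (r : X ≃ᵢ X) (P : Set X) : Prop where
  refl : IsReflection r
  isOpen : IsOpen P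
  convex : IsGeodConvex P
  mem_or : ∀ x ∉ wall r, x ∈ P ∨ r x ∈ P
  not_mem : ∀ x ∈ P, r x ∉ P
  comp : ∀ x ∈ P, P = connectedComponentIn (wall r)ᶜ x

lemma isOpen_component (hX : IsGeodesicSpace X) {U : Set X} (hU : IsOpen U) (x : X) :
    IsOpen (connectedComponentIn U x) := by
  rw [Metric.isOpen_iff]
  intro y hy
  obtain ⟨ε, hε, hb⟩ := Metric.isOpen_iff.1 hU y (connectedComponentIn_subset _ _ hy)
  refine ⟨ε, hε, ?_⟩
  rw [connectedComponentIn_eq hy]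
  exact (isPreconnected_ball hX y ε).subset_connectedComponentIn (Metric.mem_ball_self hε) hb

lemma IsReflection.isHalfSpace (hX : IsGeodesicSpace X) {r : X ≃ᵢ X} (hr : IsReflection r) {c : X}
    (hc : c ∉ wall r) : IsHalfSpace r (connectedComponentIn (wall r)ᶜ c) := by
  have hinv := hr.apply_apply
  have hr' := hr
  obtain ⟨h1, h2, A, B, hAB, hcomp, hA, hB, hrA, hrB⟩ := hr'
  wlog hcA : connectedComponentIn (wall r)ᶜ c = A generalizing A B
  · refine this B A hAB.symm (by rw [hcomp, Set.pair_comm]) hB hA hrB hrA ?_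
    have : connectedComponentIn (wall r)ᶜ c ∈ componentsOf (wall r)ᶜ := ⟨c, hc, rfl⟩
    rw [hcomp] at this
    exact this.resolve_left hcA
  have hself : ∀ x ∉ wall r, x ∈ connectedComponentIn (wall r)ᶜ x :=
    fun x hx => mem_connectedComponentIn hx
  refine ⟨hr, isOpen_component hX (isClosed_wall r).isOpen_compl c, hcA ▸ hA, ?_, ?_,
    fun x hx => connectedComponentIn_eq hx⟩
  · intro x hx
    have : connectedComponentIn (wall r)ᶜ x ∈ componentsOf (wall r)ᶜ := ⟨x, hx, rfl⟩
    rw [hcomp] at this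
    rw [hcA]
    rcases this with h | h
    · exact Or.inl (h ▸ hself x hx)
    · right
      rw [← hrB]
      exact ⟨x, Set.mem_singleton_iff.1 h ▸ hself x hx, rfl⟩
  · intro x hx hrx
    have hBx : x ∈ B := by
      rw [hcA, ← hrB] at hrx
      obtain ⟨y, hy, hyx⟩ := hrx
      rwa [← r.injective hyx]
    obtain ⟨b, hb, hBb⟩ : B ∈ componentsOf (wall r)ᶜ := by rw [hcomp]; simp
    refine hAB ?_
    rw [hBb] at hBx ⊢
    rw [← hcA, connectedComponentIn_eq hx, connectedComponentIn_eq hBx]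

namespace IsHalfSpace

variable {r : X ≃ᵢ X} {P : Set X}

lemma notMem_wall (h : IsHalfSpace r P) {x : X} (hx : x ∈ P) : x ∉ wall r := fun hw =>
  h.not_mem x hx (by rwa [show r x = x from hw])

lemma isPreconnected (h : IsHalfSpace r P) : IsPreconnected P := by
  rcases P.eq_empty_or_nonempty with rfl | ⟨x, hx⟩
  · exact isPreconnected_empty
  · rw [h.comp x hx]; exact isPreconnected_connectedComponentIn

lemma subset_of_isPreconnected (h : IsHalfSpace r P) {K : Set X} (hK : IsPreconnected K)
    (hd : ∀ x ∈ K, x ∉ wall r) {x : X} (hx : x ∈ K) (hxP : x ∈ P) : K ⊆ P := by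
  rw [h.comp x hxP]
  exact hK.subset_connectedComponentIn hx hd

lemma eq_of_mem {P' : Set X} (h : IsHalfSpace r P) (h' : IsHalfSpace r P') {x : X} (hx : x ∈ P)
    (hx' : x ∈ P') : P = P' := by
  rw [h.comp x hx, ← h'.comp x hx']

lemma conj (h : IsHalfSpace r P) (g : X ≃ᵢ X) : IsHalfSpace (g * r * g⁻¹) (g '' P) := by
  refine ⟨h.refl.conj g, g.toHomeomorph.isOpenMap _ h.isOpen, h.convex.image g, ?_, ?_, ?_⟩
  · intro x hx
    obtain ⟨y, rfl⟩ := g.surjective x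
    rw [wall_conj, g.injective.mem_set_image] at hx
    simpa [g.injective.mem_set_image] using h.mem_or y hx
  · rintro _ ⟨y, hy, rfl⟩
    simpa [g.injective.mem_set_image] using h.not_mem y hy
  · rintro _ ⟨y, hy, rfl⟩
    rw [wall_conj, ← Set.image_compl_eq g.bijective]
    conv_lhs => rw [h.comp y hy]
    exact g.toHomeomorph.image_connectedComponentIn (h.notMem_wall hy)

/-- The reflection maps a half-space to the opposite one. -/
lemma image_self (h : IsHalfSpace r P) : IsHalfSpace r (r '' P) := by
  have := h.conj r
  rwa [mul_assoc, mul_inv_cancel, mul_one] at this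

/-- Near a point of the wall there are points of the half-space. -/
lemma exists_mem (h : IsHalfSpace r P) {p : X} (hp : p ∈ wall r) {U : Set X} (hU : IsOpen U)
    (hpU : p ∈ U) : ∃ z ∈ U, z ∈ P := by
  -- A neighbourhood of `p` that `r` keeps inside `U`: it has a point off the wall, and that point
  -- or its mirror image lies in `P`.
  have hV : IsOpen (U ∩ r ⁻¹' U) := hU.inter (hU.preimage r.continuous)
  have hpV : p ∈ U ∩ r ⁻¹' U := ⟨hpU, by rwa [Set.mem_preimage, show r p = p from hp]⟩
  obtain ⟨z, hzV, hz⟩ : ∃ z ∈ U ∩ r ⁻¹' U, z ∉ wall r := by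
    by_contra! hcon
    have : p ∈ interior (wall r) := mem_interior.2 ⟨_, hcon, hV, hpV⟩
    rw [h.refl.2.1] at this
    exact this
  rcases h.mem_or z hz with h1 | h1
  · exact ⟨z, hzV.1, h1⟩
  · exact ⟨r z, hzV.2, h1⟩

/-- A geodesic that leaves a half-space crosses the wall, and has a point on the wall before which
it stays in the half-space. -/
lemma exists_exit (h : IsHalfSpace r P) {γ : ℝ → X} {x y : X} (hγ : IsGeodesic γ x y)
    (hx : x ∈ P) (hy : y ∉ P) : ∃ u ∈ Set.Icc 0 (dist x y), γ u ∈ wall r ∧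
      ∀ t, 0 ≤ t → t < u → γ t ∈ P := by
  have hcont := hγ.unitSpeedOn.continuousOn
  have hK : IsCompact (Set.Icc 0 (dist x y) ∩ γ ⁻¹' wall r) := by
    refine isCompact_Icc.of_isClosed_subset ?_ Set.inter_subset_left
    exact hcont.preimage_isClosed_of_isClosed isClosed_Icc (isClosed_wall r)
  have hsub : ∀ u ∈ Set.Icc 0 (dist x y), (∀ t, 0 ≤ t → t ≤ u → γ t ∉ wall r) → γ u ∈ P := by
    intro u hu ht
    refine h.subset_of_isPreconnected (K := γ '' Set.Icc 0 u)
      (isPreconnected_Icc.image _ (hcont.mono (Set.Icc_subset_Icc_right hu.2))) ?_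
      ⟨0, ⟨le_rfl, hu.1⟩, hγ.1⟩ hx ⟨u, ⟨hu.1, le_rfl⟩, rfl⟩
    rintro _ ⟨t, ht', rfl⟩
    exact ht t ht'.1 ht'.2
  have hne : (Set.Icc 0 (dist x y) ∩ γ ⁻¹' wall r).Nonempty := by
    by_contra hcon
    rw [Set.not_nonempty_iff_eq_empty] at hcon
    refine hy ?_
    rw [← hγ.2.1]
    refine hsub _ ⟨dist_nonneg, le_rfl⟩ fun t h0 ht hw => ?_
    have : t ∈ Set.Icc 0 (dist x y) ∩ γ ⁻¹' wall r := ⟨⟨h0, ht⟩, hw⟩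
    rwa [hcon] at this
  obtain ⟨u, hu⟩ := hK.exists_isLeast hne
  refine ⟨u, hu.1.1, hu.1.2, fun t h0 ht => hsub t ⟨h0, ht.le.trans hu.1.1.2⟩ ?_⟩
  intro t' h0' ht' hw
  have := hu.2 ⟨⟨h0', ht'.trans (ht.le.trans hu.1.1.2)⟩, hw⟩
  linarith

/-- Reflecting a point to the side of `x` brings it closer to `x`. -/
lemma dist_lt (h : IsHalfSpace r P) (hX : IsGeodesicSpace X) {x y : X} (hx : x ∈ P) (hy : y ∉ P)
    (hry : r y ∈ P) : dist x (r y) < dist x y := by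
  obtain ⟨γ, hγ⟩ := hX x y
  obtain ⟨u, hu, huw, -⟩ := h.exists_exit hγ hx hy
  have hγu := hγ.unitSpeedOn
  have hfix : r (γ u) = γ u := huw
  have h1 : dist x (γ u) = u := by
    have := hγu.dist_zero hu.1 hu.2
    rwa [hγ.1] at this
  have h2 : dist (γ u) (r y) = dist x y - u := by
    conv_lhs => rw [← hfix]
    rw [r.dist_eq]
    have := hγu u hu _ ⟨dist_nonneg, le_rfl⟩
    rw [hγ.2.1] at this
    rw [this, abs_sub_comm, abs_of_nonneg (by linarith [hu.2])]
  -- In case of equality, following `γ` to the wall and then its mirror image is a geodesic between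
  -- two points of `P`. It touches the wall, against convexity.
  refine lt_of_le_of_ne (by linarith [dist_triangle x (γ u) (r y)]) fun heq => ?_
  have hβ : UnitSpeedOn (fun t => r (γ (u + t))) (dist x y - u) := by
    intro s hs t ht
    rw [r.dist_eq, hγu _ ⟨by linarith [hs.1, hu.1], by linarith [hs.2]⟩ _
      ⟨by linarith [ht.1, hu.1], by linarith [ht.2]⟩]
    congr 1; ring
  have hc := (hγu.mono hu.2).concat hβ hu.1 (by linarith [hu.2]) (by simp [hfix])
    (by simp only [add_sub_cancel, hγ.1, hγ.2.1]; exact heq)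
  rw [add_sub_cancel] at hc
  rcases hu.2.eq_or_lt with he | hlt
  · have : γ u = y := by rw [he, hγ.2.1]
    refine hy ?_
    rw [this] at hfix
    rwa [hfix] at hry
  have hg := hc.isGeodesic dist_nonneg
  simp only [hu.1, if_true, hlt.not_ge, if_false, add_sub_cancel, hγ.1, hγ.2.1] at hg
  have := h.convex x hx (r y) hry _ hg u (by rw [heq]; exact hu)
  simp only [le_refl, if_true] at this
  exact h.notMem_wall this huw

end IsHalfSpace

end HalfSpaces

/-! ### Chambers: simple transitivity, local finiteness, cocompactness -/

section Chambers

variable {X : Type*} [MetricSpace X] {W : Subgroup (X ≃ᵢ X)} {C : Set X} {S : Set (X ≃ᵢ X)}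

lemma reflections_conj {g r : X ≃ᵢ X} (hg : g ∈ W) (hr : r ∈ reflections W) :
    g * r * g⁻¹ ∈ reflections W :=
  ⟨W.mul_mem (W.mul_mem hg hr.1) (W.inv_mem hg), hr.2.conj g⟩

/-- The complement of all walls. -/
def regularSet (W : Subgroup (X ≃ᵢ X)) : Set X := (⋃ r ∈ reflections W, wall r)ᶜ

lemma mem_regularSet {x : X} : x ∈ regularSet W ↔ ∀ r ∈ reflections W, x ∉ wall r := by
  simp [regularSet]

lemma apply_mem_regularSet {g : X ≃ᵢ X} (hg : g ∈ W) {x : X} (hx : x ∈ regularSet W) :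
    g x ∈ regularSet W := by
  rw [mem_regularSet] at hx ⊢
  intro r hr hw
  refine hx _ (reflections_conj (W.inv_mem hg) hr) ?_
  rw [wall_conj]
  exact ⟨_, hw, IsometryEquiv.inv_apply_self g x⟩

namespace IsChamber

lemma nonempty (hC : IsChamber W C) : C.Nonempty := by
  obtain ⟨x, hx, rfl⟩ := hC
  exact ⟨x, mem_connectedComponentIn hx⟩

lemma isPreconnected (hC : IsChamber W C) : IsPreconnected C := by
  obtain ⟨x, hx, rfl⟩ := hC
  exact isPreconnected_connectedComponentIn

lemma subset_regularSet (hC : IsChamber W C) : C ⊆ regularSet W := by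
  obtain ⟨x, hx, rfl⟩ := hC
  exact connectedComponentIn_subset _ _

lemma notMem_wall (hC : IsChamber W C) {x : X} (hx : x ∈ C) {r : X ≃ᵢ X} (hr : r ∈ reflections W) :
    x ∉ wall r :=
  mem_regularSet.1 (hC.subset_regularSet hx) r hr

lemma subset_of_isPreconnected (hC : IsChamber W C) {K : Set X} (hK : IsPreconnected K)
    (hd : K ⊆ regularSet W) {x : X} (hx : x ∈ K) (hxC : x ∈ C) : K ⊆ C := by
  obtain ⟨y, hy, rfl⟩ := hC
  rw [connectedComponentIn_eq hxC]
  exact hK.subset_connectedComponentIn hx hd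

lemma posHalf_eq (hC : IsChamber W C) {r : X ≃ᵢ X} (hr : r ∈ reflections W) {c : X} (hc : c ∈ C) :
    posHalf C r = connectedComponentIn (wall r)ᶜ c := by
  refine Set.Subset.antisymm (Set.iUnion₂_subset fun d hd => ?_) fun x hx =>
    Set.mem_iUnion₂.2 ⟨c, hc, hx⟩
  rw [connectedComponentIn_eq (x := c) (y := d)]
  exact hC.isPreconnected.subset_connectedComponentIn hc (fun x hx => hC.notMem_wall hx hr) hd

lemma isHalfSpace (hC : IsChamber W C) (hX : IsGeodesicSpace X) {r : X ≃ᵢ X}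
    (hr : r ∈ reflections W) : IsHalfSpace r (posHalf C r) := by
  obtain ⟨c, hc⟩ := hC.nonempty
  rw [hC.posHalf_eq hr hc]
  exact hr.2.isHalfSpace hX (hC.notMem_wall hc hr)

lemma subset_posHalf (hC : IsChamber W C) {r : X ≃ᵢ X} (hr : r ∈ reflections W) :
    C ⊆ posHalf C r := fun c hc => by
  rw [hC.posHalf_eq hr hc]
  exact mem_connectedComponentIn (hC.notMem_wall hc hr)

lemma image_subset (hC : IsChamber W C) {C' : Set X} (hC' : IsChamber W C') {g : X ≃ᵢ X}
    (hg : g ∈ W) {x : X} (hx : x ∈ C) (hgx : g x ∈ C') : g '' C ⊆ C' := by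
  refine hC'.subset_of_isPreconnected (hC.isPreconnected.image _ g.continuous.continuousOn) ?_
    ⟨x, hx, rfl⟩ hgx
  rintro _ ⟨y, hy, rfl⟩
  exact apply_mem_regularSet hg (hC.subset_regularSet hy)

lemma image_eq (hC : IsChamber W C) {C' : Set X} (hC' : IsChamber W C') {g : X ≃ᵢ X}
    (hg : g ∈ W) {x : X} (hx : x ∈ C) (hgx : g x ∈ C') : g '' C = C' := by
  refine (hC.image_subset hC' hg hx hgx).antisymm fun y hy => ?_
  have := hC'.image_subset hC (W.inv_mem hg) hgx (by simpa using hx)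
  exact ⟨g⁻¹ y, this ⟨y, hy, rfl⟩, g.apply_symm_apply y⟩

end IsChamber

lemma IsMinimalCutting.mem_iff (hS : IsMinimalCutting W C S) {x : X} :
    x ∈ C ↔ ∀ s ∈ S, x ∈ posHalf C s := by
  conv_lhs => rw [hS.2.1]
  simp

lemma IsMinimalCutting.closure_le (hS : IsMinimalCutting W C S) : Subgroup.closure S ≤ W :=
  (Subgroup.closure_le _).2 fun _ hs => (hS.1 hs).1

lemma ActsProperly.finite_dist_le (hP : ActsProperly W) (x y : X) (N : ℝ) :
    {g : X ≃ᵢ X | g ∈ W ∧ dist (g x) y ≤ N}.Finite := by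
  refine (hP x (max N 0 + dist x y + 1)
    (by linarith [le_max_right N 0, dist_nonneg (x := x) (y := y)])).subset ?_
  rintro g ⟨hg, hd⟩
  refine ⟨hg, ?_⟩
  rw [Metric.mem_ball]
  linarith [dist_triangle_right (g x) x y, le_max_left N 0]

/-- Each regular point can be moved into the chamber by the reflections in its walls. -/
lemma IsMinimalCutting.exists_mem_closure (hS : IsMinimalCutting W C S) (hX : IsGeodesicSpace X)
    (hP : ActsProperly W) (hC : IsChamber W C) {d : X} (hd : d ∈ regularSet W) :
    ∃ w ∈ Subgroup.closure S, w d ∈ C := by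
  obtain ⟨c, hc⟩ := hC.nonempty
  -- By properness some translate of `d` is nearest to `c`. If it were outside `C`, reflecting it in
  -- a wall of `S` that separates it from `c` would bring it nearer.
  set A : Set (X ≃ᵢ X) := {g | g ∈ Subgroup.closure S ∧ dist (g d) c ≤ dist d c}
  have hA : A.Finite := (hP.finite_dist_le d c (dist d c)).subset
    fun g hg => ⟨hS.closure_le hg.1, hg.2⟩
  obtain ⟨w, hw, hmin⟩ := Set.exists_min_image A (fun g => dist (g d) c) hA
    ⟨1, one_mem _, le_rfl⟩
  refine ⟨w, hw.1, ?_⟩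
  by_contra hwC
  obtain ⟨s, hs, hsw⟩ : ∃ s ∈ S, w d ∉ posHalf C s := by
    by_contra! hcon
    exact hwC (hS.mem_iff.2 hcon)
  have hH := hC.isHalfSpace hX (hS.1 hs)
  have hreg := mem_regularSet.1 (apply_mem_regularSet (hS.closure_le hw.1) hd) s (hS.1 hs)
  have hlt := hH.dist_lt hX (hC.subset_posHalf (hS.1 hs) hc) hsw ((hH.mem_or _ hreg).resolve_left hsw)
  rw [dist_comm c, dist_comm c] at hlt
  have := hmin (s * w) ⟨mul_mem (Subgroup.subset_closure hs) hw.1, hlt.le.trans hw.2⟩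
  exact absurd hlt this.not_gt

/-- No nontrivial element of `W` maps a point of a chamber into the same chamber. -/
lemma IsMinimalCutting.eq_one (hS : IsMinimalCutting W C S) (hX : IsGeodesicSpace X)
    (hW : IsCocompactDiscreteReflectionGroup W) (hC : IsChamber W C) {g : X ≃ᵢ X} (hg : g ∈ W)
    {x : X} (hx : x ∈ C) (hgx : g x ∈ C) : g = 1 := by
  obtain ⟨-, hP, C₀, hC₀, -, hstab⟩ := hW
  obtain ⟨d, hd⟩ := hC₀.nonempty
  obtain ⟨w, hw, hwd⟩ := hS.exists_mem_closure hX hP hC (hC₀.subset_regularSet hd)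
  have hw := hS.closure_le hw
  have h1 := hC₀.image_eq hC hw hd hwd
  have h2 := hC.image_eq hC hg hx hgx
  have h3 : (w⁻¹ : X ≃ᵢ X) '' C = C₀ := hC.image_eq hC₀ (W.inv_mem hw) hwd (by simpa using hd)
  -- Only `C₀` is assumed to have trivial stabilizer; conjugation by `w` transfers this to `C`.
  have h4 := hstab (w⁻¹ * g * w) (W.mul_mem (W.mul_mem (W.inv_mem hw) hg) hw) (by
    change (w⁻¹ : X ≃ᵢ X) ∘ g ∘ w '' C₀ = C₀
    rw [Set.image_comp, Set.image_comp, h1, h2, h3])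
  rw [mul_assoc, inv_mul_eq_one] at h4
  exact (mul_eq_right.1 h4.symm)

lemma IsMinimalCutting.isCompact_closure (hS : IsMinimalCutting W C S) (hX : IsGeodesicSpace X)
    (hW : IsCocompactDiscreteReflectionGroup W) (hC : IsChamber W C) : IsCompact (closure C) := by
  obtain ⟨-, hP, C₀, hC₀, hcpt, -⟩ := hW
  obtain ⟨d, hd⟩ := hC₀.nonempty
  obtain ⟨w, hw, hwd⟩ := hS.exists_mem_closure hX hP hC (hC₀.subset_regularSet hd)
  rw [← hC₀.image_eq hC (hS.closure_le hw) hd hwd]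
  exact (w.toHomeomorph.image_closure C₀) ▸ hcpt.image w.continuous

lemma IsMinimalCutting.closure_eq (hS : IsMinimalCutting W C S) (hX : IsGeodesicSpace X)
    (hW : IsCocompactDiscreteReflectionGroup W) (hC : IsChamber W C) :
    Subgroup.closure S = W := by
  refine hS.closure_le.antisymm fun g hg => ?_
  obtain ⟨c, hc⟩ := hC.nonempty
  obtain ⟨w, hw, hwg⟩ := hS.exists_mem_closure hX hW.2.1 hC
    (apply_mem_regularSet hg (hC.subset_regularSet hc))
  have := hS.eq_one hX hW hC (g := w * g) (W.mul_mem (hS.closure_le hw) hg) hc hwg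
  rw [eq_inv_of_mul_eq_one_right this]
  exact inv_mem hw

/-- Walls are locally finite: a reflection whose wall comes within `ε` of `x` moves `x` by at most
`2ε`. Near `x` only finitely many closed sets with empty interior are removed. -/
lemma dense_regularSet (hP : ActsProperly W) :
    Dense (regularSet W) := by
  intro x
  rw [Metric.mem_closure_iff]
  intro ε hε
  set R₀ := {r | r ∈ reflections W ∧ dist (r x) x ≤ 2 * ε}
  have hfin : R₀.Finite := (hP.finite_dist_le x x (2 * ε)).subset fun r hr => ⟨hr.1.1, hr.2⟩
  have hdense : ∀ A : Set (X ≃ᵢ X), A.Finite → A ⊆ R₀ →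
      Dense (⋂ r ∈ A, (wall r)ᶜ) ∧ IsOpen (⋂ r ∈ A, (wall r)ᶜ) := by
    intro A hA
    induction A, hA using Set.Finite.induction_on with
    | empty => simp
    | insert _ _ ih =>
      rename_i r A _ _
      intro hsub
      obtain ⟨h1, h2⟩ := ih ((Set.subset_insert _ _).trans hsub)
      rw [Set.biInter_insert]
      have hr := (hsub (Set.mem_insert _ _)).1
      refine ⟨Dense.inter_of_isOpen_left ?_ h1 (isClosed_wall r).isOpen_compl,
        (isClosed_wall r).isOpen_compl.inter h2⟩
      exact interior_eq_empty_iff_dense_compl.1 hr.2.2.1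
  obtain ⟨y, hy, hyx⟩ := (hdense R₀ hfin subset_rfl).1.exists_dist_lt x hε
  refine ⟨y, mem_regularSet.2 fun r hr hw => ?_, hyx⟩
  refine Set.mem_iInter₂.1 hy r ⟨hr, ?_⟩ hw
  have h1 : dist (r x) y = dist x y := by
    conv_lhs => rw [← show r y = y from hw]
    exact r.dist_eq x y
  linarith [dist_triangle_right (r x) x y]

/-- The orbit of every point is coarsely dense. -/
lemma IsMinimalCutting.exists_orbit_dist_le (hS : IsMinimalCutting W C S) (hX : IsGeodesicSpace X)
    (hW : IsCocompactDiscreteReflectionGroup W) (hC : IsChamber W C) {c : X} (hc : c ∈ C) (x : X) :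
    ∃ w ∈ W, dist x (w c) ≤ 1 + Metric.diam (closure C) := by
  obtain ⟨d, hd, hdx⟩ := (dense_regularSet hW.2.1).exists_dist_lt x one_pos
  obtain ⟨w, hw, hwd⟩ := hS.exists_mem_closure hX hW.2.1 hC hd
  refine ⟨w⁻¹, W.inv_mem (hS.closure_le hw), ?_⟩
  have h1 : dist d (w⁻¹ c) ≤ Metric.diam (closure C) := by
    rw [← w.dist_eq, show w (w⁻¹ c) = c from w.apply_symm_apply c]
    exact Metric.dist_le_diam_of_mem (hS.isCompact_closure hX hW hC).isBounded
      (subset_closure hwd) (subset_closure hc)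
  linarith [dist_triangle x d (w⁻¹ c)]

/-- Finitely many translates of the compact set `closure C` cover the regular points of a ball, and
by density the whole ball. -/
lemma IsMinimalCutting.properSpace (hS : IsMinimalCutting W C S) (hX : IsGeodesicSpace X)
    (hW : IsCocompactDiscreteReflectionGroup W) (hC : IsChamber W C) : ProperSpace X := by
  refine ⟨fun x ρ => ?_⟩
  obtain ⟨c, hc⟩ := hC.nonempty
  have hcpt := hS.isCompact_closure hX hW hC
  set A := {g : X ≃ᵢ X | g ∈ W ∧ dist (g c) x ≤ ρ + 1 + Metric.diam (closure C)}
  have hA : A.Finite := hW.2.1.finite_dist_le c x _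
  have hU : IsCompact (⋃ g ∈ A, g '' closure C) :=
    hA.isCompact_biUnion fun g _ => hcpt.image g.continuous
  refine hU.of_isClosed_subset Metric.isClosed_closedBall fun y hy => ?_
  have hy' : y ∈ closure (Metric.ball x (ρ + 1) ∩ regularSet W) := by
    refine (dense_regularSet hW.2.1).open_subset_closure_inter Metric.isOpen_ball ?_
    rw [Metric.mem_closedBall] at hy
    rw [Metric.mem_ball]; linarith
  refine hU.isClosed.closure_subset_iff.2 ?_ hy'
  rintro d ⟨hdx, hd⟩
  obtain ⟨w, hw, hwd⟩ := hS.exists_mem_closure hX hW.2.1 hC hd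
  refine Set.mem_iUnion₂.2 ⟨w⁻¹, ⟨W.inv_mem (hS.closure_le hw), ?_⟩, w d, subset_closure hwd,
    w.symm_apply_apply d⟩
  have h1 : dist (w⁻¹ c) d ≤ Metric.diam (closure C) := by
    rw [← w.dist_eq, show w (w⁻¹ c) = c from w.apply_symm_apply c]
    exact Metric.dist_le_diam_of_mem hcpt.isBounded (subset_closure hc) (subset_closure hwd)
  rw [Metric.mem_ball] at hdx
  linarith [dist_triangle (w⁻¹ c) d x]

end Chambers

/-! ### Panels, galleries, and word length -/

section Galleries

variable {X : Type*} [MetricSpace X] {W : Subgroup (X ≃ᵢ X)} {C : Set X} {S : Set (X ≃ᵢ X)}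

namespace IsMinimalCutting

/-- The chamber has a point of its closure on the wall of `s` that lies inside all other
half-spaces. -/
lemma exists_panel_point (hS : IsMinimalCutting W C S) (hX : IsGeodesicSpace X)
    (hC : IsChamber W C) {s : X ≃ᵢ X} (hs : s ∈ S) :
    ∃ p ∈ wall s, p ∈ closure C ∧ ∀ t ∈ S, t ≠ s → p ∈ posHalf C t := by
  obtain ⟨c, hc⟩ := hC.nonempty
  have hcP := fun t (ht : t ∈ S) => hC.subset_posHalf (hS.1 ht) hc
  have hH := fun t (ht : t ∈ S) => hC.isHalfSpace hX (hS.1 ht)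
  -- This is minimality of `S`. The geodesic from `c ∈ C` to `y` stays in all the other half-spaces,
  -- so the point where it first meets the wall of `s` lies on the panel.
  obtain ⟨y, hy, hyC⟩ : ∃ y, (∀ t ∈ S, t ≠ s → y ∈ posHalf C t) ∧ y ∉ C := by
    by_contra! hcon
    refine hS.2.2 s hs (Set.Subset.antisymm (fun x hx => ?_) fun x hx => ?_)
    · exact Set.mem_iInter₂.2 fun t ht => hC.subset_posHalf (hS.1 ht.1) hx
    · exact hcon x fun t ht hts => Set.mem_iInter₂.1 hx t ⟨ht, hts⟩
  have hys : y ∉ posHalf C s := fun h => hyC <| hS.mem_iff.2 fun t ht => by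
    by_cases hts : t = s
    · exact hts ▸ h
    · exact hy t ht hts
  obtain ⟨γ, hγ⟩ := hX c y
  obtain ⟨u, hu, huw, hlt⟩ := (hH s hs).exists_exit hγ (hcP s hs) hys
  have hin : ∀ t ∈ S, t ≠ s → ∀ v ∈ Set.Icc 0 (dist c y), γ v ∈ posHalf C t :=
    fun t ht hts v hv => (hH t ht).convex c (hcP t ht) y (hy t ht hts) γ hγ v hv
  refine ⟨γ u, huw, ?_, fun t ht hts => hin t ht hts u hu⟩
  have hu0 : 0 < u := by
    refine lt_of_le_of_ne hu.1 fun h => ?_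
    rw [← h, hγ.1] at huw
    exact (hH s hs).notMem_wall (hcP s hs) huw
  rw [Metric.mem_closure_iff]
  intro ε hε
  have hv0 : 0 ≤ max 0 (u - ε / 2) := le_max_left _ _
  have hvu : max 0 (u - ε / 2) < u := max_lt hu0 (by linarith)
  refine ⟨γ (max 0 (u - ε / 2)), hS.mem_iff.2 fun t ht => ?_, ?_⟩
  · by_cases hts : t = s
    · exact hts ▸ hlt _ hv0 hvu
    · exact hin t ht hts _ ⟨hv0, hvu.le.trans hu.2⟩
  · rw [hγ.2.2 u hu _ ⟨hv0, hvu.le.trans hu.2⟩, abs_of_pos (by linarith)]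
    linarith [le_max_right 0 (u - ε / 2)]

/-- A panel point in `closure C` is fixed by `s`, hence equally far from `c` and `s c`. -/
lemma dist_apply_le (hS : IsMinimalCutting W C S) (hX : IsGeodesicSpace X)
    (hW : IsCocompactDiscreteReflectionGroup W) (hC : IsChamber W C) {s : X ≃ᵢ X} (hs : s ∈ S)
    {c : X} (hc : c ∈ C) : dist c (s c) ≤ 2 * Metric.diam (closure C) := by
  obtain ⟨p, hps, hpC, -⟩ := hS.exists_panel_point hX hC hs
  have h1 : dist c p ≤ Metric.diam (closure C) :=
    Metric.dist_le_diam_of_mem (hS.isCompact_closure hX hW hC).isBounded (subset_closure hc) hpC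
  have h2 : dist p (s c) = dist c p := by
    conv_lhs => rw [← show s p = p from hps]
    rw [s.dist_eq, dist_comm]
  linarith [dist_triangle c p (s c)]

lemma finite (hS : IsMinimalCutting W C S) (hX : IsGeodesicSpace X)
    (hW : IsCocompactDiscreteReflectionGroup W) (hC : IsChamber W C) : S.Finite := by
  obtain ⟨c, hc⟩ := hC.nonempty
  refine (hW.2.1.finite_dist_le c c (2 * Metric.diam (closure C))).subset fun s hs =>
    ⟨(hS.1 hs).1, ?_⟩
  rw [dist_comm]
  exact hS.dist_apply_le hX hW hC hs hc

/-- The only wall that separates `C` from the adjacent chamber `s C` is the wall of `s`. -/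
lemma apply_mem_posHalf (hS : IsMinimalCutting W C S) (hX : IsGeodesicSpace X)
    (hW : IsCocompactDiscreteReflectionGroup W) (hC : IsChamber W C) {s r : X ≃ᵢ X} (hs : s ∈ S)
    (hr : r ∈ reflections W) (hrs : r ≠ s) {c : X} (hc : c ∈ C) : s c ∈ posHalf C r := by
  by_contra hcon
  have hsW := (hS.1 hs).1
  have hHr := hC.isHalfSpace hX hr
  have hHs := hC.isHalfSpace hX (hS.1 hs)
  have hss := hHs.refl.apply_apply
  have hneg : ∀ d ∈ C, s d ∉ posHalf C r := by
    intro d hd hsd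
    refine hcon (hHr.subset_of_isPreconnected (K := s '' C)
      (hC.isPreconnected.image _ s.continuous.continuousOn) ?_ ⟨d, hd, rfl⟩ hsd ⟨c, hc, rfl⟩)
    rintro _ ⟨x, hx, rfl⟩
    exact mem_regularSet.1 (apply_mem_regularSet hsW (hC.subset_regularSet hx)) r hr
  obtain ⟨p, hps, -, hpt⟩ := hS.exists_panel_point hX hC hs
  have hfin := hS.finite hX hW hC
  -- As `S` is finite, `p` has a ball inside all other half-spaces. In it, `C` is exactly the
  -- positive side of `s`, and `s C` the negative one.
  have hU : IsOpen (⋂ t ∈ S \ {s}, posHalf C t) :=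
    (hfin.subset Set.sdiff_subset).isOpen_biInter fun t ht =>
      (hC.isHalfSpace hX (hS.1 ht.1)).isOpen
  obtain ⟨ε, hε, hball⟩ := Metric.isOpen_iff.1 hU p
    (Set.mem_iInter₂.2 fun t ht => hpt t ht.1 ht.2)
  have hBC : ∀ x ∈ Metric.ball p ε, x ∈ posHalf C s → x ∈ C := by
    refine fun x hx hxs => hS.mem_iff.2 fun t ht => ?_
    by_cases hts : t = s
    · exact hts ▸ hxs
    · exact Set.mem_iInter₂.1 (hball hx) t ⟨ht, hts⟩
  have hsp : s p = p := hps
  have hBs : ∀ x ∈ Metric.ball p ε, s x ∈ Metric.ball p ε := by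
    intro x hx
    rw [Metric.mem_ball] at hx ⊢
    conv_lhs => rw [← hsp]
    rwa [s.dist_eq]
  have hBsC : ∀ x ∈ Metric.ball p ε, s x ∈ posHalf C s → ∃ d ∈ C, s d = x :=
    fun x hx hsx => ⟨s x, hBC _ (hBs x hx) hsx, hss x⟩
  -- Both `C` and `s C` accumulate at `p` and lie on opposite sides of the wall of `r`.
  have hpr : p ∈ wall r := by
    by_contra hpr
    rcases hHr.mem_or p hpr with h | h
    · obtain ⟨z, hz, hzs⟩ := hHs.image_self.exists_mem (p := p)
        (by simpa using hps)
        (Metric.isOpen_ball.inter hHr.isOpen) ⟨Metric.mem_ball_self hε, h⟩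
      obtain ⟨y, hy, rfl⟩ := hzs
      obtain ⟨d, hd, hde⟩ := hBsC _ hz.1 (by rwa [hss])
      rw [← hde] at hz
      exact hneg d hd hz.2
    · obtain ⟨z, hz, hzs⟩ := hHs.exists_mem hps
        (Metric.isOpen_ball.inter (hHr.isOpen.preimage r.continuous))
        ⟨Metric.mem_ball_self hε, h⟩
      exact hHr.not_mem z (hC.subset_posHalf hr (hBC z hz.1 hzs)) hz.2
  obtain ⟨z₀, hz₀, hz₀s⟩ := hHs.exists_mem hps Metric.isOpen_ball (Metric.mem_ball_self hε)
  have hrr := hHr.refl.apply_apply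
  have hV : IsOpen (r '' (Metric.ball p ε ∩ posHalf C s)) :=
    r.toHomeomorph.isOpenMap _ (Metric.isOpen_ball.inter hHs.isOpen)
  -- For such `x ∈ C` the point `r x` is not in `C`, hence is on the negative side of `s` within the
  -- ball. So `s r` maps `x` into `C`, which forces `r = s`.
  obtain ⟨_, ⟨x, ⟨hxB, hxs⟩, rfl⟩, hxw⟩ :
      ∃ z ∈ r '' (Metric.ball p ε ∩ posHalf C s), z ∉ wall s := by
    by_contra! hc'
    have : r z₀ ∈ interior (wall s) := mem_interior.2 ⟨_, hc', hV, z₀, ⟨hz₀, hz₀s⟩, rfl⟩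
    rw [hHs.refl.2.1] at this
    exact this
  have hxC := hBC x hxB hxs
  have hrx := hHr.not_mem x (hC.subset_posHalf hr hxC)
  have hrxB : r x ∈ Metric.ball p ε := by
    rw [Metric.mem_ball] at hxB ⊢
    conv_lhs => rw [← show r p = p from hpr]
    rwa [r.dist_eq]
  have hsrx : s (r x) ∈ C := hBC _ (hBs _ hrxB) <|
    (hHs.mem_or _ hxw).resolve_left fun h => hrx (hC.subset_posHalf hr (hBC _ hrxB h))
  have := hS.eq_one hX hW hC (g := s * r) (W.mul_mem hsW hr.1) hxC hsrx
  exact hrs (by rw [eq_inv_of_mul_eq_one_right this, hHs.refl.inv_eq])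

/-- Half-spaces under the action of a generator. -/
lemma apply_mem_posHalf_iff (hS : IsMinimalCutting W C S) (hX : IsGeodesicSpace X)
    (hW : IsCocompactDiscreteReflectionGroup W) (hC : IsChamber W C) {s r : X ≃ᵢ X} (hs : s ∈ S)
    (hr : r ∈ reflections W) (hrs : r ≠ s) (x : X) :
    s x ∈ posHalf C (s * r * s⁻¹) ↔ x ∈ posHalf C r := by
  obtain ⟨c, hc⟩ := hC.nonempty
  have hsr := reflections_conj (hS.1 hs).1 hr
  have h1 := hS.apply_mem_posHalf hX hW hC hs hr hrs hc
  have h2 : posHalf C (s * r * s⁻¹) = s '' posHalf C r :=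
    (hC.isHalfSpace hX hsr).eq_of_mem ((hC.isHalfSpace hX hr).conj s)
      (hC.subset_posHalf hsr hc) ⟨s c, h1, (hS.1 hs).2.apply_apply c⟩
  rw [h2, s.injective.mem_set_image]

/-- A wall that separates `C` from `w C` is crossed by every gallery from `C` to `w C`. -/
lemma exists_crossing (hS : IsMinimalCutting W C S) (hX : IsGeodesicSpace X)
    (hW : IsCocompactDiscreteReflectionGroup W) (hC : IsChamber W C) {c : X} (hc : c ∈ C)
    (l : List (X ≃ᵢ X)) (hl : ∀ s ∈ l, s ∈ S) {r : X ≃ᵢ X} (hr : r ∈ reflections W)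
    (hrl : l.prod c ∉ posHalf C r) :
    ∃ l₁ s l₂, l = l₁ ++ s :: l₂ ∧ r = l₁.prod * s * l₁.prod⁻¹ := by
  induction l generalizing r with
  | nil => exact absurd (hC.subset_posHalf hr hc) hrl
  | cons s l ih =>
    have hs : s ∈ S := hl s (by simp)
    by_cases hrs : r = s
    · exact ⟨[], s, l, rfl, by simp [hrs]⟩
    · have hsi := (hS.1 hs).2.inv_eq
      have hr' := reflections_conj (hS.1 hs).1 hr
      have hne : s * r * s⁻¹ ≠ s := fun h => hrs (by
        have := congrArg (fun g => s⁻¹ * g * s) h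
        simpa [mul_assoc] using this)
      have hback : s * (s * r * s⁻¹) * s⁻¹ = r := by
        rw [hsi, mul_assoc, mul_assoc, mul_assoc, (hS.1 hs).2.1, mul_one, ← mul_assoc,
          (hS.1 hs).2.1, one_mul]
      -- As `r ≠ s`, the first step from `C` to `s C` does not cross the wall of `r`; undoing it
      -- leaves a shorter gallery and the wall of `s r s⁻¹`.
      have h := hS.apply_mem_posHalf_iff hX hW hC hs hr' hne (l.prod c)
      rw [hback] at h
      obtain ⟨l₁, t, l₂, hl', hrt⟩ := ih (fun t ht => hl t (by simp [ht])) hr'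
        fun h' => hrl (by rw [List.prod_cons]; exact h.2 h')
      refine ⟨s :: l₁, t, l₂, by simp [hl'], ?_⟩
      rw [← hback, hrt, List.prod_cons]
      group

/-- `S` generates `W` and consists of involutions, so some word in `S` represents `w`, and the
infimum is attained rather than being the default value 0. -/
lemma exists_list (hS : IsMinimalCutting W C S) (hX : IsGeodesicSpace X)
    (hW : IsCocompactDiscreteReflectionGroup W) (hC : IsChamber W C) {w : X ≃ᵢ X} (hw : w ∈ W) :
    ∃ l : List (X ≃ᵢ X), (∀ s ∈ l, s ∈ S) ∧ l.prod = w ∧ l.length = wordLength S w := by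
  rw [← hS.closure_eq hX hW hC] at hw
  have hinv : S ∪ S⁻¹ = S := by
    refine Set.union_eq_left.2 fun s hs => ?_
    have hs' : s⁻¹ ∈ S := hs
    have := (hS.1 hs').2.inv_eq
    rw [inv_inv] at this
    rwa [this]
  rw [← Subgroup.mem_toSubmonoid, Subgroup.closure_toSubmonoid, hinv] at hw
  obtain ⟨l, hl, hlw⟩ := Submonoid.exists_list_of_mem_closure hw
  exact Nat.sInf_mem (s := {n : ℕ | ∃ l : List (X ≃ᵢ X), (∀ s ∈ l, s ∈ S) ∧ l.prod = w ∧
    l.length = n}) ⟨_, l, hl, hlw, rfl⟩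

lemma prod_reverse (hS : IsMinimalCutting W C S) (l : List (X ≃ᵢ X)) (hl : ∀ s ∈ l, s ∈ S) :
    l.reverse.prod = l.prod⁻¹ := by
  induction l with
  | nil => simp
  | cons s l ih =>
    rw [List.reverse_cons, List.prod_append, ih fun t ht => hl t (by simp [ht]), List.prod_singleton,
      List.prod_cons, mul_inv_rev, (hS.1 (hl s (by simp))).2.inv_eq]

/-- If right multiplication by a generator lengthens `w`, then its wall does not separate
`C` from `w⁻¹ C`. -/
lemma inv_apply_mem_posHalf (hS : IsMinimalCutting W C S) (hX : IsGeodesicSpace X)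
    (hW : IsCocompactDiscreteReflectionGroup W) (hC : IsChamber W C) {c : X} (hc : c ∈ C)
    {w t : X ≃ᵢ X} (hw : w ∈ W) (ht : t ∈ S) (hwt : wordLength S w < wordLength S (w * t)) :
    w⁻¹ c ∈ posHalf C t := by
  by_contra hcon
  obtain ⟨l, hl, hlw, hlen⟩ := hS.exists_list hX hW hC hw
  rw [← hlw, ← hS.prod_reverse l hl] at hcon
  obtain ⟨l₁, s, l₂, hl', hts⟩ := hS.exists_crossing hX hW hC hc l.reverse
    (fun s hs => hl s (List.mem_reverse.1 hs)) (hS.1 ht) hcon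
  have hsub : ∀ q ∈ l₁ ++ l₂, q ∈ S := fun q hq => hl q (List.mem_reverse.1 (by
    rw [hl']; simp only [List.mem_append, List.mem_cons] at hq ⊢; tauto))
  have hs : s ∈ S := hl s (List.mem_reverse.1 (by rw [hl']; simp))
  -- The exchange argument: deleting the letter at the crossing gives a word for `w t` shorter than
  -- `w`.
  have hprod : (l₁ ++ l₂).reverse.prod = w * t := by
    rw [hS.prod_reverse _ hsub, List.prod_append]
    have h1 := hS.prod_reverse l hl
    rw [hl', List.prod_append, List.prod_cons, hlw] at h1
    have h2 : t * w⁻¹ = l₁.prod * l₂.prod := by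
      rw [← h1, hts]
      have hss := (hS.1 hs).2.1
      calc l₁.prod * s * l₁.prod⁻¹ * (l₁.prod * (s * l₂.prod))
          = l₁.prod * (s * s) * l₂.prod := by group
        _ = _ := by rw [hss, mul_one]
    rw [← h2, mul_inv_rev, inv_inv, (hS.1 ht).2.inv_eq]
  have hle : wordLength S (w * t) ≤ (l₁ ++ l₂).length := Nat.sInf_le
    ⟨(l₁ ++ l₂).reverse, fun q hq => hsub q (List.mem_reverse.1 hq), hprod, List.length_reverse⟩
  have := congrArg List.length hl'
  simp only [List.length_reverse, List.length_append, List.length_cons] at this hle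
  omega

/-- Turns quasi-density in the word metric into a bound in `X`. -/
lemma dist_apply_le_wordLength (hS : IsMinimalCutting W C S) (hX : IsGeodesicSpace X)
    (hW : IsCocompactDiscreteReflectionGroup W) (hC : IsChamber W C) {c : X} (hc : c ∈ C)
    {w : X ≃ᵢ X} (hw : w ∈ W) :
    dist c (w c) ≤ wordLength S w * (2 * Metric.diam (closure C)) := by
  obtain ⟨l, hl, hlw, hlen⟩ := hS.exists_list hX hW hC hw
  rw [← hlen, ← hlw]
  clear hlen hlw
  induction l with
  | nil => simp
  | cons s l ih =>
    have h1 := hS.dist_apply_le hX hW hC (hl s (by simp)) hc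
    have h2 := ih fun t ht => hl t (by simp [ht])
    have h3 : dist (s c) ((s :: l).prod c) = dist c (l.prod c) := by
      rw [List.prod_cons]; exact s.dist_eq _ _
    rw [List.length_cons]
    push_cast
    linarith [dist_triangle c (s c) ((s :: l).prod c)]

end IsMinimalCutting

end Galleries

/-! ### Elements of infinite order and disjoint walls -/

section Axes

variable {X : Type*} [MetricSpace X] {W : Subgroup (X ≃ᵢ X)} {C : Set X} {S : Set (X ≃ᵢ X)}

/-- All powers of `g` fix `x`, and properness allows only finitely many such elements. -/
lemma ActsProperly.isOfFinOrder (hP : ActsProperly W) {g : X ≃ᵢ X} (hg : g ∈ W) {x : X}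
    (hx : g x = x) : IsOfFinOrder g := by
  rw [← finite_powers]
  refine (hP x 1 one_pos).subset ?_
  rintro _ ⟨n, rfl⟩
  refine ⟨W.pow_mem hg n, ?_⟩
  have : (g ^ n) x = x := by
    induction n with
    | zero => rfl
    | succ k ih => rw [pow_succ, IsometryEquiv.mul_apply, hx, ih]
  simp [this]

namespace IsMinimalCutting

/-- Elements of infinite order attain their least displacement, which is positive. -/
lemma exists_min_displacement (hS : IsMinimalCutting W C S) (hX : IsGeodesicSpace X)
    (hW : IsCocompactDiscreteReflectionGroup W) (hC : IsChamber W C) {g : X ≃ᵢ X} (hg : g ∈ W)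
    (hinf : ¬ IsOfFinOrder g) :
    ∃ y, 0 < dist y (g y) ∧ ∀ x, dist y (g y) ≤ dist x (g x) := by
  have := hS.properSpace hX hW hC
  obtain ⟨c, hc⟩ := hC.nonempty
  set D := 1 + Metric.diam (closure C)
  have hD : 0 ≤ D := add_nonneg zero_le_one Metric.diam_nonneg
  -- Every point is within `D` of the orbit of `c`, so conjugating `g` moves it into the ball about
  -- `c`. If its displacement is at most `d(c, g c)`, the conjugate falls in this finite set, and
  -- only finitely many minima over a compact ball remain.
  set A := {k : X ≃ᵢ X | (∃ h ∈ W, k = h⁻¹ * g * h) ∧ dist (k c) c ≤ 2 * D + dist c (g c)}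
  have hA : A.Finite := (hW.2.1.finite_dist_le c c (2 * D + dist c (g c))).subset <| by
    rintro _ ⟨⟨h, hh, rfl⟩, hd⟩
    exact ⟨W.mul_mem (W.mul_mem (W.inv_mem hh) hg) hh, hd⟩
  have hmin : ∀ k : X ≃ᵢ X, ∃ y, ∀ x ∈ Metric.closedBall c D, dist y (k y) ≤ dist x (k x) := by
    intro k
    obtain ⟨y, -, hy⟩ := (isCompact_closedBall c D).exists_isMinOn
      ⟨c, Metric.mem_closedBall_self hD⟩
      (continuous_id.dist k.continuous).continuousOn
    exact ⟨y, hy⟩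
  choose y hy using hmin
  obtain ⟨k, ⟨⟨h, hh, rfl⟩, -⟩, hkmin⟩ := Set.exists_min_image A (fun k => dist (y k) (k (y k))) hA
    ⟨g, ⟨1, W.one_mem, by simp⟩, by rw [dist_comm]; linarith⟩
  set k := h⁻¹ * g * h
  have hconj : ∀ (h : X ≃ᵢ X) x, dist x ((h⁻¹ * g * h) x) = dist (h x) (g (h x)) := by
    intro h x
    rw [← h.dist_eq]
    simp only [IsometryEquiv.mul_apply]
    congr 1
    exact h.apply_symm_apply _
  have hle : ∀ x, dist x (g x) ≤ dist c (g c) → dist (y k) (k (y k)) ≤ dist x (g x) := by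
    intro x hx
    obtain ⟨f, hf, hfx⟩ := hS.exists_orbit_dist_le hX hW hC hc x
    have hfx' : f (f⁻¹ x) = x := f.apply_symm_apply x
    have h1 : dist (f⁻¹ x) c ≤ D := by rw [← f.dist_eq, hfx']; exact hfx
    have h2 := hconj f (f⁻¹ x)
    rw [hfx'] at h2
    have h3 : f⁻¹ * g * f ∈ A := by
      refine ⟨⟨f, hf, rfl⟩, ?_⟩
      have h4 := dist_triangle4 ((f⁻¹ * g * f) c) ((f⁻¹ * g * f) (f⁻¹ x)) (f⁻¹ x) c
      rw [(f⁻¹ * g * f).dist_eq, dist_comm c, dist_comm _ (f⁻¹ x), h2] at h4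
      linarith
    rw [← h2]
    exact (hkmin _ h3).trans (hy _ _ h1)
  have hmin' : ∀ x, dist (h (y k)) (g (h (y k))) ≤ dist x (g x) := by
    intro x
    rw [← hconj h]
    rcases le_total (dist x (g x)) (dist c (g c)) with hx | hx
    · exact hle x hx
    · exact (hle c le_rfl).trans hx
  refine ⟨h (y k), dist_pos.2 fun heq => hinf ?_, hmin'⟩
  exact hW.2.1.isOfFinOrder hg heq.symm

/-- The powers of an element of infinite order run along a ray. -/
lemma exists_axis_ray (hS : IsMinimalCutting W C S) (hX : IsCAT0 X)
    (hW : IsCocompactDiscreteReflectionGroup W) (hC : IsChamber W C) {g : X ≃ᵢ X} (hg : g ∈ W)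
    (hinf : ¬ IsOfFinOrder g) :
    ∃ (ρ : Ray X) (y : X) (L : ℝ≥0), 0 < L ∧ ∀ n : ℕ, ρ.1 (n * L) = (g ^ n) y := by
  obtain ⟨y, hpos, hmin⟩ := hS.exists_min_displacement hX.1 hW hC hg hinf
  obtain ⟨ρ, hρ⟩ := hX.exists_ray_through (p := fun n => (g ^ n) y) hpos fun m n hmn => by
    rw [← Nat.cast_sub hmn, ← hX.dist_pow_eq hmin, ← (g ^ m).dist_eq y,
      ← IsometryEquiv.mul_apply, ← pow_add, Nat.add_sub_cancel' hmn]
  exact ⟨ρ, y, _, Real.toNNReal_pos.2 hpos, hρ⟩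

/-- The wall of `s` is connected and misses that of `t`, so its panel point decides the side. -/
lemma wall_subset_posHalf (hS : IsMinimalCutting W C S) (hX : IsCAT0 X) (hC : IsChamber W C)
    {s t : X ≃ᵢ X} (hs : s ∈ S) (ht : t ∈ S) (hst : ∀ x ∈ wall s, x ∉ wall t) :
    wall s ⊆ posHalf C t := by
  obtain ⟨p, hps, -, hp⟩ := hS.exists_panel_point hX.1 hC hs
  have hts : t ≠ s := by rintro rfl; exact hst p hps hps
  exact (hC.isHalfSpace hX.1 (hS.1 ht)).subset_of_isPreconnected
    ((hX.isGeodConvex_wall s).isPreconnected hX.1) hst hps (hp t ht hts)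

/-- Negative half-spaces of disjoint walls of the chamber are disjoint. -/
lemma mem_posHalf_of_apply_mem (hS : IsMinimalCutting W C S) (hX : IsCAT0 X) (hC : IsChamber W C)
    {s t : X ≃ᵢ X} (hs : s ∈ S) (ht : t ∈ S) (hst : ∀ x ∈ wall s, x ∉ wall t) {x : X}
    (hx : s x ∈ posHalf C s) : x ∈ posHalf C t := by
  have hHs := hC.isHalfSpace hX.1 (hS.1 hs)
  have hHt := hC.isHalfSpace hX.1 (hS.1 ht)
  obtain ⟨p, hps, -, -⟩ := hS.exists_panel_point hX.1 hC hs
  obtain ⟨z, hzt, hzs⟩ := hHs.image_self.exists_mem hps hHt.isOpen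
    (hS.wall_subset_posHalf hX hC hs ht hst hps)
  refine hHt.subset_of_isPreconnected hHs.image_self.isPreconnected ?_ hzs hzt
    ⟨s x, hx, hHs.refl.apply_apply x⟩
  rintro _ ⟨y, hy, rfl⟩ hw
  exact hHs.not_mem y hy
    (hS.wall_subset_posHalf hX hC ht hs (fun x hxt hxs => hst x hxs hxt) hw)

lemma apply_mem_posHalf_iff_conj (hS : IsMinimalCutting W C S) (hX : IsGeodesicSpace X)
    (hW : IsCocompactDiscreteReflectionGroup W) (hC : IsChamber W C) {s r : X ≃ᵢ X} (hs : s ∈ S)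
    (hr : r ∈ reflections W) (hrs : r ≠ s) (x : X) :
    s x ∈ posHalf C r ↔ x ∈ posHalf C (s * r * s⁻¹) := by
  rw [← hS.apply_mem_posHalf_iff hX hW hC hs hr hrs, (hS.1 hs).2.apply_apply]

/-- A wall that meets the positive side of `t` does not separate `C` from `(ts)ⁿ C`. -/
lemma pow_apply_mem_posHalf (hS : IsMinimalCutting W C S) (hX : IsCAT0 X)
    (hW : IsCocompactDiscreteReflectionGroup W) (hC : IsChamber W C) {s t : X ≃ᵢ X} (hs : s ∈ S)
    (ht : t ∈ S) (hst : ∀ x ∈ wall s, x ∉ wall t) {c : X} (hc : c ∈ C) (n : ℕ) {r : X ≃ᵢ X}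
    (hr : r ∈ reflections W) {x : X} (hxr : x ∈ wall r) (hxt : x ∈ posHalf C t) :
    ((t * s) ^ n) c ∈ posHalf C r := by
  induction n generalizing r x with
  | zero => exact hC.subset_posHalf hr hc
  | succ n ih =>
    have hHs := hC.isHalfSpace hX.1 (hS.1 hs)
    have hHt := hC.isHalfSpace hX.1 (hS.1 ht)
    have hts : ∀ x ∈ wall t, x ∉ wall s := fun x h1 h2 => hst x h2 h1
    rw [pow_succ', IsometryEquiv.mul_apply, IsometryEquiv.mul_apply]
    have h1 : t x ∈ posHalf C s := hS.mem_posHalf_of_apply_mem hX hC ht hs hts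
      (by rwa [hHt.refl.apply_apply])
    have hw1 : t x ∈ wall (t * r * t⁻¹) := by rw [wall_conj]; exact ⟨x, hxr, rfl⟩
    have h2 : s (t x) ∈ posHalf C t := hS.mem_posHalf_of_apply_mem hX hC hs ht hst
      (by rwa [hHs.refl.apply_apply])
    have hr1 := reflections_conj (hS.1 ht).1 hr
    -- Neither `t` nor `s` is the reflection in the current wall, which passes through `X_t^+` and
    -- then `X_s^+`. Removing both letters yields a wall through `s (t x) ∈ X_t^+`, ready for
    -- induction.
    rw [hS.apply_mem_posHalf_iff_conj hX.1 hW hC ht hr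
        (by rintro rfl; exact hHt.notMem_wall hxt hxr),
      hS.apply_mem_posHalf_iff_conj hX.1 hW hC hs hr1
        (fun h => hHs.notMem_wall h1 (h ▸ hw1))]
    refine ih (reflections_conj (hS.1 hs).1 hr1) (x := s (t x)) ?_ h2
    rw [wall_conj]
    exact ⟨_, hw1, rfl⟩

/-- If `a` ends only in `s`, and the walls of `s` and `t` are disjoint, then geodesics from
`a⁻¹ C` to `(ts)ⁿ⁺¹ C` pass through `C`. -/
lemma exists_mem_of_isGeodesic (hS : IsMinimalCutting W C S) (hX : IsCAT0 X)
    (hW : IsCocompactDiscreteReflectionGroup W) (hC : IsChamber W C) {s t : X ≃ᵢ X} (hs : s ∈ S)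
    (ht : t ∈ S) (hst : ∀ x ∈ wall s, x ∉ wall t) {c : X} (hc : c ∈ C) (n : ℕ) {a : X ≃ᵢ X}
    (ha : a ∈ endingOnlyIn W S s) {γ : ℝ → X}
    (hγ : IsGeodesic γ (a⁻¹ c) (((t * s) ^ (n + 1)) c)) :
    ∃ u ∈ Set.Icc 0 (dist (a⁻¹ c) (((t * s) ^ (n + 1)) c)), γ u ∈ C := by
  obtain ⟨⟨haW, hal⟩, ha1⟩ := ha
  have hts : ∀ x ∈ wall t, x ∉ wall s := fun x h1 h2 => hst x h2 h1
  have hH := fun r (hr : r ∈ S) => hC.isHalfSpace hX.1 (hS.1 hr)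
  set x := a⁻¹ c
  set z := ((t * s) ^ (n + 1)) c
  have hx : ∀ r ∈ S, r ≠ s → x ∈ posHalf C r := fun r hr hrs =>
    hS.inv_apply_mem_posHalf hX.1 hW hC hc haW hr (hal r ⟨hr, hrs⟩)
  have hxs : s x ∈ posHalf C s := by
    have hxs' : x ∉ posHalf C s := by
      intro h
      have hxC : x ∈ C := hS.mem_iff.2 fun r hr => by
        by_cases hrs : r = s
        · exact hrs ▸ h
        · exact hx r hr hrs
      exact ha1 (inv_eq_one.1 (hS.eq_one hX.1 hW hC (W.inv_mem haW) hc hxC))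
    refine ((hH s hs).mem_or x ?_).resolve_left hxs'
    exact mem_regularSet.1 (apply_mem_regularSet (W.inv_mem haW) (hC.subset_regularSet hc)) s
      (hS.1 hs)
  have hz : ∀ r ∈ S, r ≠ t → z ∈ posHalf C r := fun r hr hrt => by
    obtain ⟨p, hpr, -, hp⟩ := hS.exists_panel_point hX.1 hC hr
    exact hS.pow_apply_mem_posHalf hX hW hC hs ht hst hc _ (hS.1 hr) hpr (hp t ht hrt.symm)
  have hzt : t z ∈ posHalf C t := by
    obtain ⟨p, hps, -, hp⟩ := hS.exists_panel_point hX.1 hC hs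
    have h1 : ((t * s) ^ n) c ∈ posHalf C s := hS.pow_apply_mem_posHalf hX hW hC hs ht hst hc n
      (hS.1 hs) hps (hS.wall_subset_posHalf hX hC hs ht hst hps)
    have h2 : t z = s (((t * s) ^ n) c) := by
      simp only [z]
      rw [pow_succ', IsometryEquiv.mul_apply, IsometryEquiv.mul_apply,
        (hH t ht).refl.apply_apply]
    rw [h2]
    exact hS.mem_posHalf_of_apply_mem hX hC hs ht hst (by rwa [(hH s hs).refl.apply_apply])
  have hcov : ∀ y, y ∈ posHalf C s ∪ posHalf C t := by
    intro y
    by_cases hy : y ∈ wall s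
    · exact Or.inr (hS.wall_subset_posHalf hX hC hs ht hst hy)
    · exact ((hH s hs).mem_or y hy).imp id (hS.mem_posHalf_of_apply_mem hX hC hs ht hst)
  -- The two open half-spaces cover the connected geodesic and each contains one of its ends, so
  -- they meet on it.
  have hpre : IsPreconnected (γ '' Set.Icc 0 (dist x z)) :=
    isPreconnected_Icc.image _ hγ.unitSpeedOn.continuousOn
  obtain ⟨_, ⟨u, hu, rfl⟩, hus, hut⟩ := hpre _ _ (hH s hs).isOpen (hH t ht).isOpen
    (fun y _ => hcov y)
    ⟨z, ⟨_, ⟨dist_nonneg, le_rfl⟩, hγ.2.1⟩, hS.mem_posHalf_of_apply_mem hX hC ht hs hts hzt⟩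
    ⟨x, ⟨_, ⟨le_rfl, dist_nonneg⟩, hγ.1⟩, hS.mem_posHalf_of_apply_mem hX hC hs ht hst hxs⟩
  refine ⟨u, hu, hS.mem_iff.2 fun r hr => ?_⟩
  by_cases hrs : r = s
  · exact hrs ▸ hus
  by_cases hrt : r = t
  · exact hrt ▸ hut
  exact (hH r hr).convex x (hx r hr hrs) z (hz r hr hrt) γ hγ u hu

end IsMinimalCutting

end Axes

/-! ### Neighbourhoods of boundary points in the cone topology -/

section ConeTopology

variable {X : Type*} [MetricSpace X]

lemma IsCAT0.tendsto_cone (hX : IsCAT0 X) (η : Ray X) {z : ℕ → X} {τ : ℕ → ℝ≥0} {K : ℝ}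
    (hτ : Tendsto τ atTop atTop) (hz : ∀ n, dist (z n) (η.1 (τ n)) ≤ K) :
    Tendsto (fun n => (Sum.inl (z n) : X ⊕ Boundary X)) atTop
      (@nhds _ (coneTopology (η.1 0)) (Sum.inr η.endpoint)) := by
  rw [TopologicalSpace.tendsto_nhds_generateFrom_iff]
  rintro U (⟨V, -, rfl⟩ | ⟨c, r, ε, hc, -, -, rfl⟩) hU
  · simp at hU
  · obtain ⟨y, ⟨η', h0, hend, rfl⟩, hlt⟩ := hU
    -- The ray from the base point to a given endpoint is unique, so membership in the cone
    -- neighbourhood is a statement about `η r`, with slack `ε - dist (η r) (c r)`.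
    rw [hX.ray_eq (h0.trans hc) hend] at hlt
    filter_upwards [hX.eventually_close η hτ hz r (sub_pos.2 hlt)] with n hn
    obtain ⟨γ, hγ⟩ := hX.1 (η.1 0) (z n)
    refine ⟨γ r, ⟨by rw [hc]; exact hn.1, γ, by rw [hc]; exact hγ, rfl⟩, ?_⟩
    linarith [hn.2 γ hγ, dist_triangle (γ r) (η.1 r) (c.1 r)]

/-- Every neighbourhood of the endpoint of a ray contains the endpoints of the rays that pass
close to a sufficiently distant point of it. -/
lemma IsCAT0.exists_close_subset (hX : IsCAT0 X) (ξ : Ray X) {U : Set (X ⊕ Boundary X)}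
    (hU : IsOpen[coneTopology (ξ.1 0)] U) (hξ : Sum.inr ξ.endpoint ∈ U) :
    ∃ (r : ℝ≥0) (ε : ℝ), 0 < ε ∧ ∀ η : Ray X, η.1 0 = ξ.1 0 → dist (η.1 r) (ξ.1 r) < ε →
      Sum.inr η.endpoint ∈ U := by
  induction hU with
  | basic U hg =>
    rcases hg with ⟨V, -, rfl⟩ | ⟨c, r, ε, hc, -, -, rfl⟩
    · simp at hξ
    · obtain ⟨y, ⟨ξ', h0, hend, rfl⟩, hlt⟩ := hξ
      rw [hX.ray_eq (h0.trans hc) hend] at hlt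
      refine ⟨r, _, sub_pos.2 hlt, fun η hη hd => ⟨η.1 r, ⟨η, hη.trans hc.symm, rfl, rfl⟩, ?_⟩⟩
      linarith [dist_triangle (η.1 r) (ξ.1 r) (c.1 r)]
  | univ => exact ⟨0, 1, one_pos, fun _ _ _ => trivial⟩
  | inter U V _ _ ihU ihV =>
    obtain ⟨r₁, ε₁, hε₁, h₁⟩ := ihU hξ.1
    obtain ⟨r₂, ε₂, hε₂, h₂⟩ := ihV hξ.2
    refine ⟨max r₁ r₂, min ε₁ ε₂, lt_min hε₁ hε₂, fun η hη hd => ?_⟩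
    -- Rays with a common origin are no farther apart at a smaller parameter.
    have hmono : ∀ r ≤ max r₁ r₂, dist (η.1 r) (ξ.1 r) < min ε₁ ε₂ := fun r hr => by
      have := hX.dist_le_of_le (η.unitSpeedOn (max r₁ r₂ : ℝ≥0)) (ξ.unitSpeedOn (max r₁ r₂ : ℝ≥0))
        (by simpa using hη) r.coe_nonneg (by exact_mod_cast hr)
      simp only [Real.toNNReal_coe] at this
      exact this.trans_lt hd
    exact ⟨h₁ η hη ((hmono r₁ (le_max_left _ _)).trans_le (min_le_left _ _)),
      h₂ η hη ((hmono r₂ (le_max_right _ _)).trans_le (min_le_right _ _))⟩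
  | sUnion s _ ih =>
    obtain ⟨V, hV, hξV⟩ := hξ
    obtain ⟨r, ε, hε, h⟩ := ih V hV hξV
    exact ⟨r, ε, hε, fun η hη hd => ⟨V, hV, h η hη hd⟩⟩

end ConeTopology

/-! ### Shadows of chambers and density -/

section Density

variable {X : Type*} [MetricSpace X] {W : Subgroup (X ≃ᵢ X)} {C : Set X} {S : Set (X ≃ᵢ X)}

/-- The conjugate of `ts` by an element that ends only in `s` has its limit point in the shadow
of `a C`: a ray with the same origin as `ξ` leads to it, and passes near each point of `ξ` that is
close to `a C`. -/
lemma IsMinimalCutting.exists_limit_near (hS : IsMinimalCutting W C S) (hX : IsCAT0 X)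
    (hW : IsCocompactDiscreteReflectionGroup W) (hC : IsChamber W C) {s t : X ≃ᵢ X} (hs : s ∈ S)
    (ht : t ∈ S) (hst : ¬ IsOfFinOrder (s * t)) {a : X ≃ᵢ X} (ha : a ∈ endingOnlyIn W S s) {c : X}
    (hc : c ∈ C) (ξ : Ray X) (T : ℝ≥0) :
    ∃ w ∈ W, ¬ IsOfFinOrder w ∧ ∃ η : Ray X, η.1 0 = ξ.1 0 ∧
      IsLimitOfPowers (ξ.1 0) w η.endpoint ∧
      dist (η.1 T) (ξ.1 T) ≤
        1 + 4 * dist (ξ.1 0) c + 2 * Metric.diam (closure C) + 2 * dist (ξ.1 T) (a c) := by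
  have haW : a ∈ W := ha.1.1
  have hsW := (hS.1 hs).1
  have htW := (hS.1 ht).1
  have hts : ¬ IsOfFinOrder (t * s) := by
    rw [← (hS.1 hs).2.inv_eq, ← (hS.1 ht).2.inv_eq, ← mul_inv_rev, isOfFinOrder_inv_iff]
    exact hst
  have hdisj : ∀ x ∈ wall s, x ∉ wall t := by
    intro x hxs hxt
    refine hst (hW.2.1.isOfFinOrder (W.mul_mem hsW htW) (x := x) ?_)
    rw [IsometryEquiv.mul_apply, show t x = x from hxt, show s x = x from hxs]
  set w := a * (t * s) * a⁻¹
  have hwW : w ∈ W := W.mul_mem (W.mul_mem haW (W.mul_mem htW hsW)) (W.inv_mem haW)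
  have hpow : ∀ n, w ^ n = a * (t * s) ^ n * a⁻¹ := fun n => conj_pow
  have hwinf : ¬ IsOfFinOrder w := by
    rw [isOfFinOrder_iff_pow_eq_one] at hts ⊢
    simpa only [hpow, conj_eq_one_iff] using hts
  have := hS.properSpace hX.1 hW hC
  obtain ⟨ρ, y, L, hL, hρ⟩ := hS.exists_axis_ray hX hW hC hwW hwinf
  obtain ⟨η, hη0, hηρ⟩ := hX.exists_ray ρ (ξ.1 0)
  obtain ⟨K, hK⟩ : ∃ K : ℝ, ∀ t, dist (η.1 t) (ρ.1 t) ≤ K := Quotient.exact hηρ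
  have hτ : Tendsto (fun n : ℕ => (n : ℝ≥0) * L) atTop atTop :=
    tendsto_natCast_atTop_atTop.atTop_mul_const hL
  have hnear : ∀ x (n : ℕ), dist ((w ^ n) x) (η.1 (n * L)) ≤ dist x y + K := by
    intro x n
    have h1 := hK (n * L)
    rw [hρ, dist_comm] at h1
    linarith [dist_triangle ((w ^ n) x) ((w ^ n) y) (η.1 (n * L)), (w ^ n).dist_eq x y]
  refine ⟨w, hwW, hwinf, η, hη0, ?_, ?_⟩
  · have := hX.tendsto_cone η hτ (hnear (ξ.1 0))
    rwa [hη0] at this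
  set δ := dist (ξ.1 0) c
  -- The second requirement puts `z` farther than `T + d(ξ 0, c)` from `ξ 0`, so that the geodesic
  -- from `c` to `z` also has length at least `T`.
  obtain ⟨n, ⟨hn1, hn2⟩, hn3, -⟩ := (((tendsto_add_atTop_nat 1).eventually
    (hX.eventually_close η hτ (hnear (a c)) T one_pos)).and ((tendsto_add_atTop_nat 1).eventually
    (hX.eventually_close η hτ (hnear (a c)) (T + nndist (ξ.1 0) c) one_pos))).exists
  rw [hη0] at hn1 hn2 hn3
  set z := (w ^ (n + 1)) (a c)
  have hz : z = a (((t * s) ^ (n + 1)) c) := by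
    simp only [z, hpow, IsometryEquiv.mul_apply, IsometryEquiv.inv_apply_self]
  have hTz : (T : ℝ) ≤ dist c z := by
    have := hn3
    rw [NNReal.coe_add, coe_nndist] at this
    linarith [dist_triangle (ξ.1 0) c z]
  obtain ⟨γ, hγ⟩ := hX.1 (ξ.1 0) z
  obtain ⟨σ, hσ⟩ := hX.1 c z
  have h1 := hn2 γ hγ
  have h2 := hX.dist_le_of_common_end hγ hσ T.coe_nonneg hn1.le hTz
  have hσ' := hσ.comp_isometry a⁻¹
  rw [hz, IsometryEquiv.inv_apply_self] at hσ'
  obtain ⟨u, hu, huC⟩ := hS.exists_mem_of_isGeodesic hX hW hC hs ht hdisj hc n ha hσ'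
  have hdist : dist (a⁻¹ c) (((t * s) ^ (n + 1)) c) = dist c z := by
    rw [hz, ← a.dist_eq]
    congr 1
    exact a.apply_symm_apply c
  rw [hdist] at hu
  have h3 : dist (σ u) (a c) ≤ Metric.diam (closure C) := by
    rw [← (a⁻¹).dist_eq, IsometryEquiv.inv_apply_self]
    exact Metric.dist_le_diam_of_mem (hS.isCompact_closure hX.1 hW hC).isBounded
      (subset_closure huC) (subset_closure hc)
  have h4 : dist c (σ u) = u := by
    have := hσ.unitSpeedOn.dist_zero hu.1 hu.2
    rwa [hσ.1] at this
  have h5 : dist (ξ.1 0) (ξ.1 T) = T := by rw [ξ.2.dist_eq, NNReal.dist_eq]; simp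
  have h6 : dist (σ u) (ξ.1 T) ≤ Metric.diam (closure C) + dist (ξ.1 T) (a c) :=
    (dist_triangle_right _ _ (a c)).trans (add_le_add h3 le_rfl)
  have h7 : dist (σ T) (σ u) ≤ δ + (Metric.diam (closure C) + dist (ξ.1 T) (a c)) := by
    rw [hσ.2.2 T ⟨T.2, hTz⟩ u hu, abs_le]
    have e1 := dist_triangle4 c (ξ.1 0) (ξ.1 T) (σ u)
    have e2 := dist_triangle4 (ξ.1 0) c (σ u) (ξ.1 T)
    rw [dist_comm c (ξ.1 0)] at e1
    rw [dist_comm (ξ.1 T) (σ u)] at e1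
    constructor <;> linarith
  -- The chain `η T`, `γ T`, `σ T`, `σ u`, `ξ T` contributes `1`, `3δ`, then `δ` plus diameter plus
  -- `d(ξ T, a c)`, and finally the last two again.
  have h8 := dist_triangle4 (η.1 T) (γ T) (σ T) (ξ.1 T)
  rw [dist_comm (η.1 T) (γ T)] at h8
  linarith [dist_triangle (σ T) (σ u) (ξ.1 T)]

end Density

end ReflCAT

theorem mainTheorem6 {X : Type*} [MetricSpace X] (hX : ReflCAT.IsCAT0 X)
    (W : Subgroup (X ≃ᵢ X)) (hW : ReflCAT.IsCocompactDiscreteReflectionGroup W)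
    (C : Set X) (hC : ReflCAT.IsChamber W C)
    (S : Set (X ≃ᵢ X)) (hS : ReflCAT.IsMinimalCutting W C S)
    (hqd : ReflCAT.IsQuasiDense S (W : Set (X ≃ᵢ X))
      (⋃ s ∈ {s | s ∈ S ∧ ∃ t ∈ S, ¬ IsOfFinOrder (s * t)}, ReflCAT.endingOnlyIn W S s))
    (x₀ : X) :
    @Dense (ReflCAT.Boundary X) (ReflCAT.boundaryTopology x₀)
      {α | ∃ w ∈ W, ¬ IsOfFinOrder w ∧ ReflCAT.IsLimitOfPowers x₀ w α} := by
  let := ReflCAT.boundaryTopology x₀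
  have := hS.properSpace hX.1 hW hC
  obtain ⟨c, hc⟩ := hC.nonempty
  obtain ⟨-, N, -, hN⟩ := hqd
  intro α
  obtain ⟨ρ, rfl⟩ : ∃ ρ : ReflCAT.Ray X, ρ.endpoint = α := Quotient.exists_rep α
  obtain ⟨ξ, rfl, hξ⟩ := hX.exists_ray ρ x₀
  rw [← hξ, mem_closure_iff]
  rintro _ ⟨U, hU, rfl⟩ hξU
  obtain ⟨r, ε, hε, hsub⟩ := hX.exists_close_subset ξ hU hξU
  set δ := Metric.diam (closure C)
  have hδ : 0 ≤ δ := Metric.diam_nonneg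
  -- The bound of `exists_limit_near` when `d(ξ T, a c) ≤ 1 + δ + N (2δ)`: the first two terms reach
  -- the orbit of `c`, the last one comes from quasi-density.
  set D : ℝ := 1 + 4 * dist (ξ.1 0) c + 2 * δ + 2 * (1 + δ + N * (2 * δ))
  have hD : 0 ≤ D := by positivity
  -- Since `D` does not depend on `T`, this choice gives `(r / T) D < ε`.
  set T : ℝ := r * D / ε + r + 1
  have hr := r.coe_nonneg
  have hq : 0 ≤ r * D / ε := by positivity
  have hrT : r + 1 ≤ T := by simp only [T]; linarith
  have hT : 0 < T := by linarith
  obtain ⟨h, hh, hhT⟩ := hS.exists_orbit_dist_le hX.1 hW hC hc (ξ.1 T.toNNReal)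
  obtain ⟨a, ha, haN⟩ := hN h hh
  obtain ⟨s, ⟨hs, t, ht, hst⟩, ha⟩ := Set.mem_iUnion₂.1 ha
  have h1 : dist (h c) (a c) ≤ N * (2 * δ) := by
    have e := hS.dist_apply_le_wordLength hX.1 hW hC hc (W.mul_mem (W.inv_mem hh) ha.1.1)
    rw [← h.dist_eq, IsometryEquiv.mul_apply, show h (h⁻¹ (a c)) = a c from h.apply_symm_apply _]
      at e
    refine e.trans (mul_le_mul_of_nonneg_right ?_ (by positivity))
    exact_mod_cast haN
  obtain ⟨w, hw, hinf, η, hη0, hlim, hd⟩ :=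
    hS.exists_limit_near hX hW hC hs ht hst ha hc ξ T.toNNReal
  refine ⟨η.endpoint, hsub η hη0 ?_, w, hw, hinf, hlim⟩
  have h2 : dist (η.1 T.toNNReal) (ξ.1 T.toNNReal) ≤ D := by
    simp only [D]
    linarith [dist_triangle (ξ.1 T.toNNReal) (h c) (a c)]
  have key := hX.dist_le (η.unitSpeedOn T) (ξ.unitSpeedOn T) (by simpa using hη0) hT hr
    (by linarith)
  simp only [Real.toNNReal_coe] at key
  refine (key.trans (mul_le_mul_of_nonneg_left h2 (by positivity))).trans_lt ?_
  rw [div_mul_eq_mul_div, div_lt_iff₀ hT, ← div_lt_iff₀' hε]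
  simp only [T]; linarith
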